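/- **Setting.** Let $\mathbb T\subset\mathbb R$ be a time scale (nonempty closed set) with jump operator $\sigma$ and graininess $\mu(t)=\sigma(t)-t$, let $t_0\in\mathbb T^*\subset\mathbb T$, and let $\delta_\pm$ be forward and backward shift operators on $\mathbb T^*$ associated with $t_0$: with $\mathcal D_\pm=\{(s,t)\in[t_0,\infty)_{\mathbb T}\times\mathbb T^*:\delta_\pm(s,t)\in\mathbb T^*\}$, (1) on $\mathcal D_\pm$, $\delta_\pm$ is strictly increasing in the second argument; (2) on $\mathcal D_-$ (resp. $\mathcal D_+$), $\delta_-$ (resp. $\delta_+$) is strictly decreasing (resp. increasing) in the first argument; (3) $(t,t_0)\in\mathcal D_+$, $\delta_+(t,t_0)=t$ for $t\in[t_0,\infty)_{\mathbb T}$, and $(t_0,t)\in\mathcal D_+$, $\delta_+(t_0,t)=t$ for $t\in\mathbb T^*$; (4) if $(s,t)\in\mathcal D_\pm$, then $(s,\delta_\pm(s,t))\in\mathcal D_\mp$ and $\delta_\mp(s,\delta_\pm(s,t))=t$; (5) if $(s,t)\in\mathcal D_\pm$ and $(u,\delta_\pm(s,t))\in\mathcal D_\mp$, then $(s,\delta_\mp(u,t))\in\mathcal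 D_\pm$ and $\delta_\mp(u,\delta_\pm(s,t))=\delta_\pm(s,\delta_\mp(u,t))$. Assume $[a,b]_{\mathbb T}\subset\mathbb T^*$ for all $a,b\in\mathbb T^*$. Let $T\in\mathbb T^*$, $T>t_0$, with $(T,t)\in\mathcal D_+\cap\mathcal D_-$ for all $t\in\mathbb T^*$, and write $\delta_\pm^T(t)=\delta_\pm(T,t)$. Let $s\in[t_0,\infty)_{\mathbb T}$ be a fixed delay with $(s,t)\in\mathcal D_-$ for all $t\in\mathbb T^*$ and $\delta_-(s,\cdot)$ continuous on $\mathbb T^*$. Consider $$x^\Delta(t)=A(t)x(t)+Q^\Delta\big(t,x(\delta_-(s,t))\big)+G\big(t,x(t),x(\delta_-(s,t))\big),\qquad t\in\mathbb T^*,\tag{5.1}$$ where $A:\mathbb T^*\to\mathbb R^{n\times n}$, $Q:\mathbb T^*\times\mathbb R^n\to\mathbb R^n$, $G:\mathbb T^*\times\mathbb R^n\times\mathbb R^n\to\mathbb R^n$ are rd-continuous (for $Q$ and $G$: substituting continuous functions of $t$ for the vector arguments gives an rd-continuous function) and $A$ is regressive ($I+\mu(t)A(t)$ is invertible for all $t\in\mathbb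 T^*$). As usual for neutral equations, $x$ solves (5.1) if $t\mapsto x(t)-Q(t,x(\delta_-(s,t)))$ is $\Delta$-differentiable on $\mathbb T^*$ with $\Delta$-derivative $A(t)x(t)+G(t,x(t),x(\delta_-(s,t)))$. Let $|\cdot|$ be the maximum norm on $\mathbb R^n$ and $|M|=\max_i\sum_j|m_{ij}|$ for matrices, let $P_T$ be the space of rd-continuous $x:\mathbb T^*\to\mathbb R^n$ with $x\circ\delta_\pm^T=x$, normed by $\|x\|=\sup_{t\in[t_0,\delta_+^T(t_0)]_{\mathbb T}}|x(t)|$, and let $\|A\|=\sup_{t\in[t_0,\infty)_{\mathbb T}}|A(t)|$, assumed finite. Let $\Phi_A$ be the transition matrix of $z^\Delta=A(t)z$, put $\Phi_A^{-1}(t,t_0)=\Phi_A(t,t_0)^{-1}$, and let $$r=\sup_{t\in[t_0,\delta_+^T(t_0)]_{\mathbb T}}\ \sup_{u\in[t,\delta_+^T(t)]_{\mathbb T}}\Big|\big[\Phi_A(\sigma(u),t_0)\big(\Phi_A^{-1}(\delta_+^T(t_0),t_0)-I\big)\Phi_A^{-1}(t,t_0)\big]^{-1}\Big|.$$ **Hypotheses.**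 (a) $z^\Delta=A(t)z$ has no nonzero solution on $\mathbb T^*$ with $z\circ\delta^T_\pm=z$. (b) $\delta_\pm^T$ are $\Delta$-differentiable on $\mathbb T^*$ with rd-continuous derivatives $\delta_\pm^{\Delta T}$, and $A(\delta_\pm^T(t))\,\delta_\pm^{\Delta T}(t)=A(t)$ for $t\in\mathbb T^*$. (c) For all $x\in P_T$ and $t\in\mathbb T^*$: $Q(\delta_\pm^T(t),x(\delta_-(s,\delta_\pm^T(t))))=Q(t,x(\delta_-(s,t)))$ and $G(\delta_\pm^T(t),x(\delta_\pm^T(t)),x(\delta_-(s,\delta_\pm^T(t))))\,\delta_\pm^{\Delta T}(t)=G(t,x(t),x(\delta_-(s,t)))$. (d) For some $t\in\mathbb T^*$, $Q^\Delta(t,0)$ exists and $Q^\Delta(t,0)+G(t,0,0)\ne0$. (e) There are positive constants $E_1,E_2,E_3,N$ such that for all $t\in[t_0,\infty)_{\mathbb T}$ and $x,y,z,w\in\mathbb R^n$: $|Q(t,x)-Q(t,y)|\le E_1|x-y|$ and $|G(t,x,y)-G(t,z,w)|\le E_2|x-z|+E_3|y-w|$; and $r(\delta_+^T(t_0)-t_0)(\|A\|E_1+E_2+E_3)\le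 N$. (f) $\kappa:=E_1+r(\delta_+^T(t_0)-t_0)(\|A\|E_1+E_2+E_3)<1$. **Theorem.** The map $H=B+C$, where $(B\varphi)(t)=Q(t,\varphi(\delta_-(s,t)))$ and $$(C\varphi)(t)=\Phi_A(t,t_0)\big(\Phi_A^{-1}(\delta_+^T(t_0),t_0)-I\big)^{-1}\int_t^{\delta_+^T(t)}\Phi_A^{-1}(\sigma(u),t_0)\big[A(u)Q(u,\varphi(\delta_-(s,u)))+G(u,\varphi(u),\varphi(\delta_-(s,u)))\big]\Delta u,$$ maps $P_T$ into itself and is a contraction there: $\|H\varphi-H\psi\|\le\kappa\|\varphi-\psi\|$ for all $\varphi,\psi\in P_T$. Moreover (5.1) has exactly one solution in $P_T$, that is, a unique solution that is $T$-periodic in shifts. -/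

import Mathlib

open Set Filter Topology

/-- The domain `𝒟` of a shift operator `δ`: all `(s, t) ∈ [t₀, ∞)_𝕋 × 𝕋*` with `δ s t ∈ 𝕋*`.
The values of `δ` outside this set are irrelevant. -/
def shiftDomain (𝕋 𝕋' : Set ℝ) (t₀ : ℝ) (δ : ℝ → ℝ → ℝ) : Set (ℝ × ℝ) :=
  {p | p.1 ∈ 𝕋 ∧ t₀ ≤ p.1 ∧ p.2 ∈ 𝕋' ∧ δ p.1 p.2 ∈ 𝕋'}

/-- A time scale `carrier` (a nonempty closed set of reals) with a forward shift `δp` and a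
backward shift `δm` on a subset `sub`, associated with the initial point `t₀ ∈ sub`. -/
structure ShiftTimeScale where
  carrier : Set ℝ
  isClosed_carrier : IsClosed carrier
  sub : Set ℝ
  sub_subset : sub ⊆ carrier
  t₀ : ℝ
  t₀_mem : t₀ ∈ sub
  δp : ℝ → ℝ → ℝ
  δm : ℝ → ℝ → ℝ
  -- strict monotonicity in the second argument
  δp_lt : ∀ s t u, (s, t) ∈ shiftDomain carrier sub t₀ δp → (s, u) ∈ shiftDomain carrier sub t₀ δp →
    t < u → δp s t < δp s u
  δm_lt : ∀ s t u, (s, t) ∈ shiftDomain carrier sub t₀ δm → (s, u) ∈ shiftDomain carrier sub t₀ δm →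
    t < u → δm s t < δm s u
  -- strict monotonicity in the first argument
  δm_anti : ∀ s₁ s₂ u, (s₁, u) ∈ shiftDomain carrier sub t₀ δm →
    (s₂, u) ∈ shiftDomain carrier sub t₀ δm → s₁ < s₂ → δm s₂ u < δm s₁ u
  δp_mono : ∀ s₁ s₂ u, (s₁, u) ∈ shiftDomain carrier sub t₀ δp →
    (s₂, u) ∈ shiftDomain carrier sub t₀ δp → s₁ < s₂ → δp s₁ u < δp s₂ u
  -- the initial point is neutral
  δp_right : ∀ t ∈ carrier, t₀ ≤ t → (t, t₀) ∈ shiftDomain carrier sub t₀ δp ∧ δp t t₀ = t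
  δp_left : ∀ t ∈ sub, (t₀, t) ∈ shiftDomain carrier sub t₀ δp ∧ δp t₀ t = t
  -- the two shifts undo each other
  δm_δp : ∀ s t, (s, t) ∈ shiftDomain carrier sub t₀ δp →
    (s, δp s t) ∈ shiftDomain carrier sub t₀ δm ∧ δm s (δp s t) = t
  δp_δm : ∀ s t, (s, t) ∈ shiftDomain carrier sub t₀ δm →
    (s, δm s t) ∈ shiftDomain carrier sub t₀ δp ∧ δp s (δm s t) = t
  -- the two shifts commute
  δm_comm : ∀ s t u, (s, t) ∈ shiftDomain carrier sub t₀ δp →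
    (u, δp s t) ∈ shiftDomain carrier sub t₀ δm →
    (s, δm u t) ∈ shiftDomain carrier sub t₀ δp ∧ δm u (δp s t) = δp s (δm u t)
  δp_comm : ∀ s t u, (s, t) ∈ shiftDomain carrier sub t₀ δm →
    (u, δm s t) ∈ shiftDomain carrier sub t₀ δp →
    (s, δp u t) ∈ shiftDomain carrier sub t₀ δm ∧ δp u (δm s t) = δm s (δp u t)

namespace ShiftTimeScale

noncomputable section

variable (S : ShiftTimeScale)

/-- The domain `𝒟₊` of the forward shift. -/
def domp : Set (ℝ × ℝ) := shiftDomain S.carrier S.sub S.t₀ S.δp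

/-- The domain `𝒟₋` of the backward shift. -/
def domm : Set (ℝ × ℝ) := shiftDomain S.carrier S.sub S.t₀ S.δm

/-- The time scale is `T`-periodic in shifts: `T ∈ (t₀, ∞) ∩ 𝕋*` and both shifts by `T` are defined
on all of `𝕋*`. -/
def IsPeriodic (T : ℝ) : Prop :=
  T ∈ S.sub ∧ S.t₀ < T ∧ ∀ t ∈ S.sub, (T, t) ∈ S.domp ∧ (T, t) ∈ S.domm

open Classical in
/-- The forward jump operator `σ(t) = inf {u ∈ 𝕋 : u > t}`, with `σ(max 𝕋) = max 𝕋`. -/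
def sigma (t : ℝ) : ℝ :=
  if (S.carrier ∩ Ioi t).Nonempty then sInf (S.carrier ∩ Ioi t) else t

/-- `f` has the `Δ`-derivative `f'` at `t`, for a function `f` on `𝕋*`. -/
def HasDeltaDeriv {E : Type*} [NormedAddCommGroup E] [NormedSpace ℝ E]
    (f : ℝ → E) (f' : E) (t : ℝ) : Prop :=
  ∀ ε > 0, ∀ᶠ u in 𝓝[S.sub] t,
    ‖f (S.sigma t) - f u - (S.sigma t - u) • f'‖ ≤ ε * |S.sigma t - u|

open Classical in
/-- The `Δ`-derivative `f^Δ(t)` (and `0` where it does not exist). -/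
def deltaDeriv {E : Type*} [NormedAddCommGroup E] [NormedSpace ℝ E] (f : ℝ → E) (t : ℝ) : E :=
  if h : ∃ f', S.HasDeltaDeriv f f' t then h.choose else 0

/-- Rd-continuity on `𝕋*`: continuity at right-dense points, and finite left limits (a void
condition at left-scattered points, where the filter below is `⊥`). -/
def RdContinuous {E : Type*} [TopologicalSpace E] (f : ℝ → E) : Prop :=
  ∀ t ∈ S.sub, (S.sigma t = t → ContinuousWithinAt f S.sub t) ∧
    ∃ L, Tendsto f (𝓝[S.sub ∩ Iio t] t) (𝓝 L)

/-- Rd-continuity of `F : 𝕋* × E → E'`: substituting a continuous function gives an rd-continuous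
function. -/
def RdContinuous₁ {E E' : Type*} [TopologicalSpace E] [TopologicalSpace E']
    (F : ℝ → E → E') : Prop :=
  ∀ y : ℝ → E, ContinuousOn y S.sub → S.RdContinuous fun t => F t (y t)

/-- Rd-continuity of `F : 𝕋* × E × E → E'`. -/
def RdContinuous₂ {E E' : Type*} [TopologicalSpace E] [TopologicalSpace E']
    (F : ℝ → E → E → E') : Prop :=
  ∀ y z : ℝ → E, ContinuousOn y S.sub → ContinuousOn z S.sub →
    S.RdContinuous fun t => F t (y t) (z t)

/-- The largest point of the time scale that is at most `x`. -/
def floor (x : ℝ) : ℝ := sSup (S.carrier ∩ Iic x)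

/-- The Lebesgue `Δ`-integral `∫_a^b f(u) Δu` for `a, b ∈ 𝕋`: the function is extended to the real
line by its value `f(u)` on each gap `[u, σ(u))`, so that a right-scattered point `u` has mass
`σ(u) - u`, and `Δ`-measure is Lebesgue measure on the set of right-dense points. -/
def deltaIntegral {E : Type*} [NormedAddCommGroup E] [NormedSpace ℝ E]
    (f : ℝ → E) (a b : ℝ) : E :=
  ∫ x in a..b, f (S.floor x)

variable {n : ℕ}

/-- The terms of the Peano-Baker series: the `k`-fold iterated integral
`∫_s^t A(τ₁) ∫_s^{τ₁} A(τ₂) ⋯ ∫_s^{τ_{k-1}} A(τ_k) Δτ_k ⋯ Δτ₁`, computed entrywise. -/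
def peanoBaker (A : ℝ → Matrix (Fin n) (Fin n) ℝ) (s : ℝ) : ℕ → ℝ → Matrix (Fin n) (Fin n) ℝ
  | 0, _ => 1
  | k + 1, t => Matrix.of fun i j =>
      S.deltaIntegral (fun τ => (A τ * peanoBaker A s k τ) i j) s t

open Classical in
/-- The transition matrix `Φ_A(t, s)` of `z^Δ = A z`: the Peano-Baker series for `s ≤ t`, and
`Φ_A(t, s) = Φ_A(s, t)⁻¹` for `t < s` (where the series need not converge). -/
def transition (A : ℝ → Matrix (Fin n) (Fin n) ℝ) (t s : ℝ) : Matrix (Fin n) (Fin n) ℝ :=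
  if s ≤ t then ∑' k, S.peanoBaker A s k t else (∑' k, S.peanoBaker A t k s)⁻¹

/-- Regressivity: `I + μ(t) A(t)` is invertible for all `t ∈ 𝕋*`, with `μ(t) = σ(t) - t`. -/
def Regressive (A : ℝ → Matrix (Fin n) (Fin n) ℝ) : Prop :=
  ∀ t ∈ S.sub, IsUnit (1 + (S.sigma t - t) • A t)

/-- `x` is invariant under both shifts by `T`. -/
def PeriodicInShifts {E : Type*} (T : ℝ) (x : ℝ → E) : Prop :=
  ∀ t ∈ S.sub, x (S.δp T t) = x t ∧ x (S.δm T t) = x t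

/-- The shifts by `T` are `Δ`-differentiable with rd-continuous derivatives. -/
def ShiftsDifferentiable (T : ℝ) : Prop :=
  (∀ t ∈ S.sub, ∃ d, S.HasDeltaDeriv (S.δp T) d t) ∧ S.RdContinuous (S.deltaDeriv (S.δp T)) ∧
    (∀ t ∈ S.sub, ∃ d, S.HasDeltaDeriv (S.δm T) d t) ∧ S.RdContinuous (S.deltaDeriv (S.δm T))

/-- `f` is `Δ`-periodic in shifts with period `T`. -/
def DeltaPeriodicInShifts {E : Type*} [AddCommGroup E] [Module ℝ E] (T : ℝ) (f : ℝ → E) : Prop :=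
  S.ShiftsDifferentiable T ∧ ∀ t ∈ S.sub,
    S.deltaDeriv (S.δp T) t • f (S.δp T t) = f t ∧ S.deltaDeriv (S.δm T) t • f (S.δm T t) = f t

/-- The space `P_T` of rd-continuous `ℝⁿ`-valued functions on `𝕋*` that are `T`-periodic in shifts
(only the values on `𝕋*` matter). -/
def periodicSpace (n : ℕ) (T : ℝ) : Set (ℝ → Fin n → ℝ) :=
  {x | S.RdContinuous x ∧ S.PeriodicInShifts T x}

/-- The norm of `P_T`: the supremum of `|x(t)|` over `[t₀, δ₊ᵀ(t₀)]_𝕋`, where `|·|` is the maximum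
norm of `ℝⁿ`. -/
def periodicNorm (T : ℝ) (x : ℝ → Fin n → ℝ) : ℝ :=
  sSup ((fun t => ‖x t‖) '' (S.carrier ∩ Icc S.t₀ (S.δp T S.t₀)))

/-- The matrix norm `|M| = max_i ∑_j |m_ij|`. -/
def rowNorm (M : Matrix (Fin n) (Fin n) ℝ) : ℝ := ⨆ i, ∑ j, |M i j|

/-- The set of all `|A(t)|` with `t ∈ [t₀, ∞)_𝕋`. -/
def rowNorms (A : ℝ → Matrix (Fin n) (Fin n) ℝ) : Set ℝ :=
  (fun t => rowNorm (A t)) '' (S.carrier ∩ Ici S.t₀)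

/-- `‖A‖ = sup {|A(t)| : t ∈ [t₀, ∞)_𝕋}`. -/
def supNorm (A : ℝ → Matrix (Fin n) (Fin n) ℝ) : ℝ := sSup (S.rowNorms A)

/-- `z^Δ = A z` is non-critical: its only `T`-periodic solution is zero. -/
def NonCritical (A : ℝ → Matrix (Fin n) (Fin n) ℝ) (T : ℝ) : Prop :=
  ∀ z : ℝ → Fin n → ℝ, (∀ t ∈ S.sub, S.HasDeltaDeriv z ((A t).mulVec (z t)) t) →
    S.PeriodicInShifts T z → ∀ t ∈ S.sub, z t = 0

/-- The constant
`r = max_t max_u |[Φ_A(σ(u), t₀) (Φ_A⁻¹(δ₊ᵀ(t₀), t₀) - I) Φ_A⁻¹(t, t₀)]⁻¹|`,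
where `t ∈ [t₀, δ₊ᵀ(t₀)]_𝕋` and `u ∈ [t, δ₊ᵀ(t)]_𝕋`. -/
def kernelBound (A : ℝ → Matrix (Fin n) (Fin n) ℝ) (T : ℝ) : ℝ :=
  sSup {ρ | ∃ t ∈ S.carrier ∩ Icc S.t₀ (S.δp T S.t₀), ∃ u ∈ S.carrier ∩ Icc t (S.δp T t),
    ρ = rowNorm (S.transition A (S.sigma u) S.t₀ *
      ((S.transition A (S.δp T S.t₀) S.t₀)⁻¹ - 1) * (S.transition A t S.t₀)⁻¹)⁻¹}

/-- `(B φ)(t) = Q(t, φ(δ₋(s, t)))`. -/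
def opB (Q : ℝ → (Fin n → ℝ) → Fin n → ℝ) (s : ℝ) (φ : ℝ → Fin n → ℝ) : ℝ → Fin n → ℝ :=
  fun t => Q t (φ (S.δm s t))

/-- `(C φ)(t) = Φ_A(t, t₀) (Φ_A⁻¹(δ₊ᵀ(t₀), t₀) - I)⁻¹ ∫_t^{δ₊ᵀ(t)} Φ_A⁻¹(σ(u), t₀)
[A(u) Q(u, φ(δ₋(s, u))) + G(u, φ(u), φ(δ₋(s, u)))] Δu`. -/
def opC (A : ℝ → Matrix (Fin n) (Fin n) ℝ) (Q : ℝ → (Fin n → ℝ) → Fin n → ℝ)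
    (G : ℝ → (Fin n → ℝ) → (Fin n → ℝ) → Fin n → ℝ) (s T : ℝ) (φ : ℝ → Fin n → ℝ) :
    ℝ → Fin n → ℝ :=
  fun t => (S.transition A t S.t₀ * ((S.transition A (S.δp T S.t₀) S.t₀)⁻¹ - 1)⁻¹).mulVec
    (S.deltaIntegral (fun u => (S.transition A (S.sigma u) S.t₀)⁻¹.mulVec
      ((A u).mulVec (Q u (φ (S.δm s u))) + G u (φ u) (φ (S.δm s u)))) t (S.δp T t))

/-- `H = B + C`. -/
def opH (A : ℝ → Matrix (Fin n) (Fin n) ℝ) (Q : ℝ → (Fin n → ℝ) → Fin n → ℝ)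
    (G : ℝ → (Fin n → ℝ) → (Fin n → ℝ) → Fin n → ℝ) (s T : ℝ) (φ : ℝ → Fin n → ℝ) :
    ℝ → Fin n → ℝ :=
  fun t => S.opB Q s φ t + S.opC A Q G s T φ t

/-- `x` solves the neutral equation
`x^Δ(t) = A(t) x(t) + Q^Δ(t, x(δ₋(s, t))) + G(t, x(t), x(δ₋(s, t)))` on `𝕋*`: as usual for neutral
equations, the function `x(t) - Q(t, x(δ₋(s, t)))` is `Δ`-differentiable, and its derivative is the
rest of the right-hand side. -/
def IsSolution (A : ℝ → Matrix (Fin n) (Fin n) ℝ) (Q : ℝ → (Fin n → ℝ) → Fin n → ℝ)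
    (G : ℝ → (Fin n → ℝ) → (Fin n → ℝ) → Fin n → ℝ) (s : ℝ) (x : ℝ → Fin n → ℝ) : Prop :=
  ∀ t ∈ S.sub, S.HasDeltaDeriv (fun u => x u - Q u (x (S.δm s u)))
    ((A t).mulVec (x t) + G t (x t) (x (S.δm s t))) t

end

end ShiftTimeScale

/-! Write Φ(t) for Φ_A(t, t₀). For a solution x, the function y(t) = x(t) - Q(t, x(δ₋(s, t)))
satisfies the linear equation y^Δ = A y + f with f = A Q + G evaluated along x. The operator C
produces the periodic solution of this equation, so the periodic solutions of the neutral equation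
are exactly the fixed points of H = B + C.

Three facts carry this. First, A(δ₊)δ₊^Δ = A and uniqueness for the linear equation give Floquet's
relation Φ(δ₊(t)) = Φ(t)Φ(T) (`transition_δp`). A vector fixed by Φ(T) would then generate a
periodic solution, so non-criticality makes Φ(T)⁻¹ - I invertible (`isUnit_inv_transition_sub_one`).
Second, the integrand of C is multiplied by Φ(T)⁻¹ under the shift, which yields both the
periodicity of Cφ (`opC_δp`) and (Cφ)^Δ = A Cφ + f (`hasDeltaDeriv_opC`). Hence fixed points are
solutions. Conversely, for a periodic solution φ, the difference φ - Hφ is a periodic solution of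
the homogeneous equation and vanishes.

Third, H contracts (`norm_opC_sub_le`). The interval [t, δ₊(t)] need not have length T - t₀, so the
integral is cut at T and the piece over [T, δ₊(t)] is pulled back to [t₀, t]. The two pieces then
have total length T - t₀, and both kernels are bounded by r. Picard iteration from 0 converges
uniformly on 𝕋* (`exists_fixed`).

The remaining work is the calculus underneath: delta derivatives and integrals, convergence of the
Peano-Baker series, and two-sided uniqueness for regressive linear equations
(`IsIntegralSolution.eq_zero_iff`). -/

namespace ShiftTimeScale

/-- The standing assumptions on the shifts: `𝕋*` is order convex in `𝕋` and the time scale is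
`T`-periodic in shifts. -/
structure ShiftPeriodic (S : ShiftTimeScale) (T : ℝ) : Prop where
  convex : ∀ a ∈ S.sub, ∀ b ∈ S.sub, S.carrier ∩ Icc a b ⊆ S.sub
  periodic : S.IsPeriodic T

variable {S : ShiftTimeScale} {T : ℝ}

/-- Neutrality of t₀ puts (t, t₀) in the domain of δ₊ with value t, and values on the domain lie in
𝕋*. -/
theorem mem_sub_of_le {t : ℝ} (ht : t ∈ S.carrier) (h0 : S.t₀ ≤ t) : t ∈ S.sub := by
  obtain ⟨h, e⟩ := S.δp_right t ht h0
  have := h.2.2.2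
  simp only at this
  rwa [e] at this

/-! ### Order properties of the shifts by T. -/

namespace ShiftPeriodic

theorem mem_of_mem_Icc (h : S.ShiftPeriodic T) {a b t : ℝ} (ha : a ∈ S.sub) (hb : b ∈ S.sub)
    (ht : t ∈ S.carrier) (hat : a ≤ t) (htb : t ≤ b) : t ∈ S.sub :=
  h.convex a ha b hb ⟨ht, hat, htb⟩

theorem δp_mem (h : S.ShiftPeriodic T) {t : ℝ} (ht : t ∈ S.sub) : S.δp T t ∈ S.sub :=
  (h.periodic.2.2 t ht).1.2.2.2

theorem δm_mem (h : S.ShiftPeriodic T) {t : ℝ} (ht : t ∈ S.sub) : S.δm T t ∈ S.sub :=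
  (h.periodic.2.2 t ht).2.2.2.2

theorem δm_δp (h : S.ShiftPeriodic T) {t : ℝ} (ht : t ∈ S.sub) : S.δm T (S.δp T t) = t :=
  (S.δm_δp T t (h.periodic.2.2 t ht).1).2

theorem δp_δm (h : S.ShiftPeriodic T) {t : ℝ} (ht : t ∈ S.sub) : S.δp T (S.δm T t) = t :=
  (S.δp_δm T t (h.periodic.2.2 t ht).2).2

theorem δp_lt (h : S.ShiftPeriodic T) {t u : ℝ} (ht : t ∈ S.sub) (hu : u ∈ S.sub) (htu : t < u) :
    S.δp T t < S.δp T u :=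
  S.δp_lt T t u (h.periodic.2.2 t ht).1 (h.periodic.2.2 u hu).1 htu

theorem δm_lt (h : S.ShiftPeriodic T) {t u : ℝ} (ht : t ∈ S.sub) (hu : u ∈ S.sub) (htu : t < u) :
    S.δm T t < S.δm T u :=
  S.δm_lt T t u (h.periodic.2.2 t ht).2 (h.periodic.2.2 u hu).2 htu

theorem δp_le (h : S.ShiftPeriodic T) {t u : ℝ} (ht : t ∈ S.sub) (hu : u ∈ S.sub) (htu : t ≤ u) :
    S.δp T t ≤ S.δp T u := by
  rcases htu.eq_or_lt with rfl | h'
  · exact le_rfl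
  · exact (h.δp_lt ht hu h').le

theorem lt_δp (h : S.ShiftPeriodic T) {t : ℝ} (ht : t ∈ S.sub) : t < S.δp T t := by
  have h1 := S.δp_left t ht
  have := S.δp_mono S.t₀ T t h1.1 (h.periodic.2.2 t ht).1 h.periodic.2.1
  rwa [h1.2] at this

theorem δm_lt_self (h : S.ShiftPeriodic T) {t : ℝ} (ht : t ∈ S.sub) : S.δm T t < t := by
  have := h.lt_δp (h.δm_mem ht)
  rwa [h.δp_δm ht] at this

theorem T_mem (h : S.ShiftPeriodic T) : T ∈ S.sub := h.periodic.1

theorem t₀_lt (h : S.ShiftPeriodic T) : S.t₀ < T := h.periodic.2.1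

theorem δp_t₀ (h : S.ShiftPeriodic T) : S.δp T S.t₀ = T :=
  (S.δp_right T (S.sub_subset h.T_mem) h.t₀_lt.le).2

/-! ### The forward jump operator -/

theorem inter_Ioi_nonempty (h : S.ShiftPeriodic T) {t : ℝ} (ht : t ∈ S.sub) :
    (S.carrier ∩ Ioi t).Nonempty :=
  ⟨S.δp T t, S.sub_subset (h.δp_mem ht), h.lt_δp ht⟩

theorem sigma_eq (h : S.ShiftPeriodic T) {t : ℝ} (ht : t ∈ S.sub) :
    S.sigma t = sInf (S.carrier ∩ Ioi t) :=
  if_pos (h.inter_Ioi_nonempty ht)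

theorem sigma_le (h : S.ShiftPeriodic T) {t u : ℝ} (ht : t ∈ S.sub) (hu : u ∈ S.carrier)
    (htu : t < u) : S.sigma t ≤ u := by
  rw [h.sigma_eq ht]
  exact csInf_le ⟨t, fun x hx => hx.2.le⟩ ⟨hu, htu⟩

theorem le_sigma (h : S.ShiftPeriodic T) {t : ℝ} (ht : t ∈ S.sub) : t ≤ S.sigma t := by
  rw [h.sigma_eq ht]
  exact le_csInf (h.inter_Ioi_nonempty ht) fun x hx => hx.2.le

theorem exists_lt_of_sigma_lt (h : S.ShiftPeriodic T) {t c : ℝ} (ht : t ∈ S.sub)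
    (hc : S.sigma t < c) : ∃ v ∈ S.carrier, t < v ∧ v < c := by
  rw [h.sigma_eq ht] at hc
  obtain ⟨v, hv, hvc⟩ := exists_lt_of_csInf_lt (h.inter_Ioi_nonempty ht) hc
  exact ⟨v, hv.1, hv.2, hvc⟩

theorem sigma_mem (h : S.ShiftPeriodic T) {t : ℝ} (ht : t ∈ S.sub) : S.sigma t ∈ S.sub := by
  refine h.mem_of_mem_Icc ht (h.δp_mem ht) ?_ (h.le_sigma ht)
    (h.sigma_le ht (S.sub_subset (h.δp_mem ht)) (h.lt_δp ht))
  rw [h.sigma_eq ht]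
  exact S.isClosed_carrier.closure_subset_iff.2 inter_subset_left
    (csInf_mem_closure (h.inter_Ioi_nonempty ht) ⟨t, fun x hx => hx.2.le⟩)

theorem le_of_lt_sigma (h : S.ShiftPeriodic T) {t u : ℝ} (ht : t ∈ S.sub) (hu : u ∈ S.carrier)
    (hut : u < S.sigma t) : u ≤ t := by
  by_contra! hc
  exact absurd (h.sigma_le ht hu hc) (not_le.2 hut)

/-- The shift is an order automorphism of 𝕋*, so it carries immediate successors to immediate
successors. At a right-dense t, a gap after δ₊(t) would be pulled back by δ₋ to a gap after t. Order
convexity keeps the intermediate points in 𝕋*. -/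
theorem sigma_δp (h : S.ShiftPeriodic T) {t : ℝ} (ht : t ∈ S.sub) :
    S.sigma (S.δp T t) = S.δp T (S.sigma t) := by
  have hσ := h.sigma_mem ht
  have hδ := h.δp_mem ht
  apply le_antisymm
  · rcases (h.le_sigma ht).eq_or_lt with e | hlt
    · rw [← e]
      by_contra! hc
      have h1 : t < S.δm T (S.sigma (S.δp T t)) := by
        have := h.δm_lt hδ (h.sigma_mem hδ) hc
        rwa [h.δm_δp ht] at this
      obtain ⟨v, hv, htv, hva⟩ := h.exists_lt_of_sigma_lt ht (e.symm.trans_lt h1)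
      have hvs := h.mem_of_mem_Icc ht (h.δm_mem (h.sigma_mem hδ)) hv htv.le hva.le
      have h2 := h.δp_lt hvs (h.δm_mem (h.sigma_mem hδ)) hva
      rw [h.δp_δm (h.sigma_mem hδ)] at h2
      exact absurd (h.sigma_le hδ (S.sub_subset (h.δp_mem hvs)) (h.δp_lt ht hvs htv)) (not_le.2 h2)
    · exact h.sigma_le hδ (S.sub_subset (h.δp_mem hσ)) (h.δp_lt ht hσ hlt)
  · by_contra! hc
    obtain ⟨u, hu, htu, hua⟩ := h.exists_lt_of_sigma_lt hδ hc
    have hus := h.mem_of_mem_Icc hδ (h.δp_mem hσ) hu htu.le hua.le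
    have h1 := h.δm_lt hδ hus htu
    have h2 := h.δm_lt hus (h.δp_mem hσ) hua
    rw [h.δm_δp ht] at h1
    rw [h.δm_δp hσ] at h2
    exact absurd (h.sigma_le ht (S.sub_subset (h.δm_mem hus)) h1) (not_le.2 h2)

end ShiftPeriodic

/-! ### The floor function -/

theorem floor_mem {a x : ℝ} (ha : a ∈ S.carrier) (hx : a ≤ x) : S.floor x ∈ S.carrier :=
  S.isClosed_carrier.closure_subset_iff.2 inter_subset_left
    (csSup_mem_closure ⟨a, ha, hx⟩ ⟨x, fun _ h => h.2⟩)

theorem floor_le {a x : ℝ} (ha : a ∈ S.carrier) (hx : a ≤ x) : S.floor x ≤ x :=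
  csSup_le ⟨a, ha, hx⟩ fun _ h => h.2

theorem le_floor {a x : ℝ} (ha : a ∈ S.carrier) (hx : a ≤ x) : a ≤ S.floor x :=
  le_csSup ⟨x, fun _ h => h.2⟩ ⟨ha, hx⟩

theorem floor_mono {a x y : ℝ} (ha : a ∈ S.carrier) (hx : a ≤ x) (hxy : x ≤ y) :
    S.floor x ≤ S.floor y :=
  le_floor (floor_mem ha hx) ((floor_le ha hx).trans hxy)

theorem isCompact_inter_Icc (S : ShiftTimeScale) (a b : ℝ) : IsCompact (S.carrier ∩ Icc a b) :=
  isCompact_Icc.inter_left S.isClosed_carrier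

namespace ShiftPeriodic

theorem floor_eq (h : S.ShiftPeriodic T) {t x : ℝ} (ht : t ∈ S.sub) (htx : t ≤ x)
    (hx : x < S.sigma t) : S.floor x = t :=
  le_antisymm (h.le_of_lt_sigma ht (floor_mem (S.sub_subset ht) htx)
    ((floor_le (S.sub_subset ht) htx).trans_lt hx)) (le_floor (S.sub_subset ht) htx)

theorem floor_mem_sub (h : S.ShiftPeriodic T) {a b x : ℝ} (ha : a ∈ S.sub) (hb : b ∈ S.sub)
    (hax : a ≤ x) (hxb : x ≤ b) : S.floor x ∈ S.sub :=
  h.mem_of_mem_Icc ha hb (floor_mem (S.sub_subset ha) hax) (le_floor (S.sub_subset ha) hax)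
    ((floor_le (S.sub_subset ha) hax).trans hxb)

/-! ### Induction principles -/

/-- Let m be the supremum of the points up to which P holds throughout. If m is not itself such a
point, it is left-dense and `hleft` gives P m; if m < b, one of the two right-hand steps goes past
m. A left-scattered point is reached from its predecessor by `hscat`. -/
theorem timeScale_induction (h : S.ShiftPeriodic T) {P : ℝ → Prop} {a b : ℝ} (ha : a ∈ S.sub)
    (hb : b ∈ S.sub) (hab : a ≤ b) (h0 : P a)
    (hscat : ∀ t ∈ S.sub, a ≤ t → t < b → t < S.sigma t → P t → P (S.sigma t))
    (hright : ∀ t ∈ S.sub, a ≤ t → t < b → S.sigma t = t → P t →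
      ∃ c > t, ∀ v ∈ S.sub, t < v → v < c → P v)
    (hleft : ∀ t ∈ S.sub, a < t → t ≤ b → (∀ c < t, ∃ v ∈ S.sub, c < v ∧ v < t) →
      (∀ v ∈ S.sub, a ≤ v → v < t → P v) → P t) : P b := by
  set Z : Set ℝ := {t | t ∈ S.carrier ∩ Icc a b ∧ ∀ v ∈ S.sub, a ≤ v → v ≤ t → P v} with hZ
  have haZ : a ∈ Z := ⟨⟨S.sub_subset ha, le_rfl, hab⟩, fun v _ h1 h2 => le_antisymm h2 h1 ▸ h0⟩
  have hbd : BddAbove Z := ⟨b, fun t ht => ht.1.2.2⟩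
  set m := sSup Z with hm
  have hmK : m ∈ S.carrier ∩ Icc a b :=
    (S.isCompact_inter_Icc a b).isClosed.closure_subset_iff.2 (fun t ht => ht.1)
      (csSup_mem_closure ⟨a, haZ⟩ hbd)
  have hms : m ∈ S.sub := h.convex a ha b hb hmK
  have hlt : ∀ v ∈ S.sub, a ≤ v → v < m → P v := fun v hv hav hvm => by
    obtain ⟨z, hz, hvz⟩ := exists_lt_of_lt_csSup ⟨a, haZ⟩ hvm
    exact hz.2 v hv hav hvz.le
  have hPm : P m := by
    by_cases hmZ : m ∈ Z
    · exact hmZ.2 m hms hmK.2.1 le_rfl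
    · have ham : a < m := lt_of_le_of_ne hmK.2.1 fun e => hmZ (e ▸ haZ)
      refine hleft m hms ham hmK.2.2 (fun c hc => ?_) hlt
      obtain ⟨z, hz, hcz⟩ := exists_lt_of_lt_csSup ⟨a, haZ⟩ hc
      exact ⟨z, h.convex a ha b hb hz.1, hcz,
        lt_of_le_of_ne (le_csSup hbd hz) fun e => hmZ (e ▸ hz)⟩
  have hle : ∀ v ∈ S.sub, a ≤ v → v ≤ m → P v := fun v hv hav hvm => by
    rcases hvm.eq_or_lt with rfl | h'
    · exact hPm
    · exact hlt v hv hav h'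
  rcases hmK.2.2.eq_or_lt with e | hmb
  · exact e ▸ hPm
  exfalso
  have key : ∃ w ∈ S.sub, m < w ∧ w ≤ b ∧ ∀ v ∈ S.sub, m < v → v ≤ w → P v := by
    rcases (h.le_sigma hms).eq_or_lt with e | hs
    · obtain ⟨c, hc, hcP⟩ := hright m hms hmK.2.1 hmb e.symm hPm
      obtain ⟨v, hv, hmv, hvc⟩ := h.exists_lt_of_sigma_lt hms
        (c := min c b) (by rw [← e]; exact lt_min hc hmb)
      exact ⟨v, h.mem_of_mem_Icc hms hb hv hmv.le (hvc.le.trans (min_le_right _ _)), hmv,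
        hvc.le.trans (min_le_right _ _), fun u hu hmu huv =>
          hcP u hu hmu (huv.trans_lt (hvc.trans_le (min_le_left _ _)))⟩
    · refine ⟨S.sigma m, h.sigma_mem hms, hs, h.sigma_le hms (S.sub_subset hb) hmb,
        fun v hv hmv hvs => ?_⟩
      rw [le_antisymm hvs (h.sigma_le hms (S.sub_subset hv) hmv)]
      exact hscat m hms hmK.2.1 hmb hs hPm
  obtain ⟨w, hw, hmw, hwb, hwP⟩ := key
  refine absurd (le_csSup hbd (show w ∈ Z from ⟨⟨S.sub_subset hw, hmK.2.1.trans hmw.le, hwb⟩,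
    fun v hv hav hvw => ?_⟩)) (not_le.2 hmw)
  rcases le_or_gt v m with h1 | h1
  · exact hle v hv hav h1
  · exact hwP v hv h1 hvw

/-- A property that holds for large `t` and is inherited by `t` from `δ₊ᵀ(t)` holds on `𝕋*`. -/
theorem shift_induction_down (h : S.ShiftPeriodic T) {P : ℝ → Prop} {c : ℝ} (hc : c ∈ S.sub)
    (h0 : ∀ t ∈ S.sub, c < t → P t) (h1 : ∀ t ∈ S.sub, P (S.δp T t) → P t) :
    ∀ t ∈ S.sub, P t := by
  by_contra! hcon
  obtain ⟨t, ht, htP⟩ := hcon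
  set Z : Set ℝ := {u | u ∈ S.sub ∧ t ≤ u ∧ ¬ P u} with hZ
  have htZ : t ∈ Z := ⟨ht, le_rfl, htP⟩
  have hZc : ∀ u ∈ Z, u ≤ c := fun u hu => by
    by_contra! hcu
    exact hu.2.2 (h0 u hu.1 hcu)
  have hbd : BddAbove Z := ⟨c, hZc⟩
  have hmK : sSup Z ∈ S.carrier ∩ Icc t c :=
    (S.isCompact_inter_Icc t c).isClosed.closure_subset_iff.2
      (fun u hu => ⟨S.sub_subset hu.1, hu.2.1, hZc u hu⟩) (csSup_mem_closure ⟨t, htZ⟩ hbd)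
  have hms : sSup Z ∈ S.sub := h.convex t ht c hc hmK
  -- Since δ₋(m) < m = sup Z, some counterexample z lies above δ₋(m); its forward shift is a
  -- counterexample above m.
  obtain ⟨z, hz, hmz⟩ := exists_lt_of_lt_csSup ⟨t, htZ⟩ (h.δm_lt_self hms)
  have h2 := h.δp_lt (h.δm_mem hms) hz.1 hmz
  rw [h.δp_δm hms] at h2
  exact absurd (le_csSup hbd (show S.δp T z ∈ Z from
    ⟨h.δp_mem hz.1, hz.2.1.trans (h.lt_δp hz.1).le, fun hP => hz.2.2 (h1 z hz.1 hP)⟩)) (not_le.2 h2)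

/-- A property that holds for small `t` and is inherited by `t` from `δ₋ᵀ(t)` holds on `𝕋*`. -/
theorem shift_induction_up (h : S.ShiftPeriodic T) {P : ℝ → Prop} {c : ℝ} (hc : c ∈ S.sub)
    (h0 : ∀ t ∈ S.sub, t < c → P t) (h1 : ∀ t ∈ S.sub, P (S.δm T t) → P t) :
    ∀ t ∈ S.sub, P t := by
  by_contra! hcon
  obtain ⟨t, ht, htP⟩ := hcon
  set Z : Set ℝ := {u | u ∈ S.sub ∧ u ≤ t ∧ ¬ P u} with hZ
  have htZ : t ∈ Z := ⟨ht, le_rfl, htP⟩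
  have hZc : ∀ u ∈ Z, c ≤ u := fun u hu => by
    by_contra! hcu
    exact hu.2.2 (h0 u hu.1 hcu)
  have hbd : BddBelow Z := ⟨c, hZc⟩
  have hmK : sInf Z ∈ S.carrier ∩ Icc c t :=
    (S.isCompact_inter_Icc c t).isClosed.closure_subset_iff.2
      (fun u hu => ⟨S.sub_subset hu.1, hZc u hu, hu.2.1⟩) (csInf_mem_closure ⟨t, htZ⟩ hbd)
  have hms : sInf Z ∈ S.sub := h.convex c hc t ht hmK
  obtain ⟨z, hz, hmz⟩ := exists_lt_of_csInf_lt ⟨t, htZ⟩ (h.lt_δp hms)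
  have h2 := h.δm_lt hz.1 (h.δp_mem hms) hmz
  rw [h.δm_δp hms] at h2
  exact absurd (csInf_le hbd (show S.δm T z ∈ Z from
    ⟨h.δm_mem hz.1, (h.δm_lt_self hz.1).le.trans hz.2.1, fun hP => hz.2.2 (h1 z hz.1 hP)⟩))
    (not_le.2 h2)

/-- Every point of `𝕋*` is equivalent under the shifts to a point of `[t₀, T]`. -/
theorem exists_mem_period (h : S.ShiftPeriodic T) {t : ℝ} (ht : t ∈ S.sub) :
    ∃ v ∈ S.carrier ∩ Icc S.t₀ T, ∀ (E : Type) (x : ℝ → E), S.PeriodicInShifts T x → x v = x t := by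
  -- Points right of t₀ are moved down into the period first; points left of t₀ are then shifted up.
  -- Quantifying over all periodic x expresses equivalence without mentioning iterates of the
  -- shifts.
  have hup : ∀ t ∈ S.sub, S.t₀ ≤ t → ∃ v ∈ S.carrier ∩ Icc S.t₀ T,
      ∀ (E : Type) (x : ℝ → E), S.PeriodicInShifts T x → x v = x t := by
    refine h.shift_induction_up (c := S.t₀) S.t₀_mem (fun t _ h1 h2 => absurd h1 (not_lt.2 h2)) ?_
    intro t ht IH h0
    rcases le_or_gt t T with htT | htT
    · exact ⟨t, ⟨S.sub_subset ht, h0, htT⟩, fun _ _ _ => rfl⟩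
    · have h1 := h.δm_lt h.T_mem ht htT
      have h2 := h.δm_δp S.t₀_mem
      rw [h.δp_t₀] at h2
      rw [h2] at h1
      obtain ⟨v, hv, hvx⟩ := IH h1.le
      exact ⟨v, hv, fun E x hx => (hvx E x hx).trans (hx t ht).2⟩
  refine h.shift_induction_down (c := S.t₀) S.t₀_mem (fun t ht h1 => hup t ht h1.le) ?_ t ht
  rintro t ht ⟨v, hv, hvx⟩
  exact ⟨v, hv, fun E x hx => (hvx E x hx).trans (hx t ht).1⟩

end ShiftPeriodic

end ShiftTimeScale

namespace ShiftTimeScale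

open MeasureTheory Asymptotics

variable {S : ShiftTimeScale} {T : ℝ}
variable {E F G : Type*} [NormedAddCommGroup E] [NormedSpace ℝ E] [NormedAddCommGroup F]
  [NormedSpace ℝ F] [NormedAddCommGroup G] [NormedSpace ℝ G]

/-! ### The delta derivative -/

theorem hasDeltaDeriv_iff_isLittleO {f : ℝ → E} {f' : E} {t : ℝ} :
    S.HasDeltaDeriv f f' t ↔
      (fun u => f (S.sigma t) - f u - (S.sigma t - u) • f') =o[𝓝[S.sub] t]
        fun u => S.sigma t - u := by
  rw [isLittleO_iff]
  rfl

theorem hasDeltaDeriv_deltaDeriv {f : ℝ → E} {t : ℝ} (h : ∃ f', S.HasDeltaDeriv f f' t) :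
    S.HasDeltaDeriv f (S.deltaDeriv f t) t := by
  rw [deltaDeriv, dif_pos h]
  exact h.choose_spec

namespace HasDeltaDeriv

/-- The neighbourhoods in the definition contain t itself, so u = t is allowed for every ε. -/
theorem apply_sigma {f : ℝ → E} {f' : E} {t : ℝ} (hf : S.HasDeltaDeriv f f' t) (ht : t ∈ S.sub) :
    f (S.sigma t) = f t + (S.sigma t - t) • f' := by
  have h1 : ∀ ε > 0, ‖f (S.sigma t) - f t - (S.sigma t - t) • f'‖ ≤ ε * |S.sigma t - t| :=
    fun ε hε => (hf ε hε).self_of_nhdsWithin ht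
  have h2 : ‖f (S.sigma t) - f t - (S.sigma t - t) • f'‖ ≤ 0 := by
    refine le_of_forall_pos_le_add fun ε hε => ?_
    have h3 : (0 : ℝ) < |S.sigma t - t| + 1 := by positivity
    refine (h1 (ε / (|S.sigma t - t| + 1)) (by positivity)).trans ?_
    rw [zero_add, div_mul_eq_mul_div, div_le_iff₀ h3]
    nlinarith
  have h4 := norm_le_zero_iff.1 h2
  rw [sub_sub, sub_eq_zero] at h4
  exact h4

theorem continuousWithinAt {f : ℝ → E} {f' : E} {t : ℝ} (hf : S.HasDeltaDeriv f f' t)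
    (ht : t ∈ S.sub) : ContinuousWithinAt f S.sub t := by
  have hid : Tendsto (fun u : ℝ => u) (𝓝[S.sub] t) (𝓝 t) := tendsto_id.mono_left nhdsWithin_le_nhds
  have hlin : Tendsto (fun u : ℝ => S.sigma t - u) (𝓝[S.sub] t) (𝓝 (S.sigma t - t)) :=
    tendsto_const_nhds.sub hid
  have h0 : Tendsto (fun u => f (S.sigma t) - f u - (S.sigma t - u) • f') (𝓝[S.sub] t) (𝓝 0) :=
    ((hasDeltaDeriv_iff_isLittleO.1 hf).trans_isBigO (hlin.isBigO_one ℝ)).tendsto_zero_of_tendsto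
      (tendsto_const_nhds (x := (1 : ℝ)))
  have h1 := ((tendsto_const_nhds (x := f (S.sigma t))).sub (hlin.smul_const f')).sub h0
  rw [hf.apply_sigma ht] at h1
  simp only [add_sub_cancel_right, sub_zero] at h1
  refine h1.congr fun u => ?_
  abel

theorem congr {f g : ℝ → E} {f' : E} {t : ℝ} (h : S.ShiftPeriodic T) (ht : t ∈ S.sub)
    (hf : S.HasDeltaDeriv f f' t) (hfg : EqOn f g S.sub) : S.HasDeltaDeriv g f' t := by
  intro ε hε
  filter_upwards [hf ε hε, self_mem_nhdsWithin] with u hu hus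
  rwa [← hfg hus, ← hfg (h.sigma_mem ht)]

theorem sub {f g : ℝ → E} {f' g' : E} {t : ℝ} (hf : S.HasDeltaDeriv f f' t)
    (hg : S.HasDeltaDeriv g g' t) : S.HasDeltaDeriv (fun u => f u - g u) (f' - g') t := by
  rw [hasDeltaDeriv_iff_isLittleO] at *
  refine (hf.sub hg).congr_left fun u => ?_
  rw [smul_sub]
  abel

theorem clm_apply {f : ℝ → E} {f' : E} {t : ℝ} (hf : S.HasDeltaDeriv f f' t) (L : E →L[ℝ] F) :
    S.HasDeltaDeriv (fun u => L (f u)) (L f') t := by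
  rw [hasDeltaDeriv_iff_isLittleO] at *
  refine ((L.isBigO_comp _ _).trans_isLittleO hf).congr_left fun u => ?_
  simp

/-- The product rule `(f g)^Δ = f^Δ g + f^σ g^Δ`. -/
theorem bilin {f : ℝ → E} {f' : E} {g : ℝ → F} {g' : F} {t : ℝ} (ht : t ∈ S.sub)
    (hf : S.HasDeltaDeriv f f' t) (hg : S.HasDeltaDeriv g g' t) (L : E →L[ℝ] F →L[ℝ] G) :
    S.HasDeltaDeriv (fun u => L (f u) (g u)) (L f' (g t) + L (f (S.sigma t)) g') t := by
  have hgc := hg.continuousWithinAt ht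
  rw [hasDeltaDeriv_iff_isLittleO] at *
  -- The remainder of the product splits into the remainder of f paired with g(u), the remainder of
  -- g paired with f(σ(t)), and (σ(t) - u) L f' (g(u) - g(t)); the last is small by continuity of g.
  have h1 : (fun u => L (f (S.sigma t) - f u - (S.sigma t - u) • f') (g u)) =o[𝓝[S.sub] t]
      fun u => S.sigma t - u := by
    have := L.isBoundedBilinearMap.isBigO_comp (l := 𝓝[S.sub] t)
      (g := fun u => f (S.sigma t) - f u - (S.sigma t - u) • f') (h := g)
    refine this.trans_isLittleO ?_
    have := hf.norm_left.mul_isBigO ((hgc.isBigO_one ℝ).norm_left)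
    simpa using this
  have h2 : (fun u => L (f (S.sigma t)) (g (S.sigma t) - g u - (S.sigma t - u) • g')) =o[𝓝[S.sub] t]
      fun u => S.sigma t - u := ((L (f (S.sigma t))).isBigO_comp _ _).trans_isLittleO hg
  have h3 : (fun u => (S.sigma t - u) • L f' (g u - g t)) =o[𝓝[S.sub] t]
      fun u => S.sigma t - u := by
    have h4 : Tendsto (fun u => L f' (g u - g t)) (𝓝[S.sub] t) (𝓝 0) := by
      have := ((L f').continuous.tendsto _).comp (hgc.sub_const (g t))
      simpa [Function.comp_def] using this
    have := (isBigO_refl (fun u => S.sigma t - u) (𝓝[S.sub] t)).smul_isLittleO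
      ((isLittleO_one_iff ℝ).2 h4)
    simpa using this
  refine ((h1.add h2).add h3).congr_left fun u => ?_
  simp only [map_sub, map_smul, _root_.sub_apply, _root_.smul_apply,
    smul_add, smul_sub]
  abel

theorem tendsto_δp (h : S.ShiftPeriodic T) {d t : ℝ} (ht : t ∈ S.sub)
    (hd : S.HasDeltaDeriv (S.δp T) d t) :
    Tendsto (S.δp T) (𝓝[S.sub] t) (𝓝[S.sub] (S.δp T t)) :=
  tendsto_nhdsWithin_iff.2 ⟨hd.continuousWithinAt ht,
    eventually_mem_nhdsWithin.mono fun _ hu => h.δp_mem hu⟩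

/-- The chain rule for the composition with a shift. -/
theorem comp_δp (h : S.ShiftPeriodic T) {d t : ℝ} (ht : t ∈ S.sub) {f : ℝ → E} {f' : E}
    (hf : S.HasDeltaDeriv f f' (S.δp T t)) (hd : S.HasDeltaDeriv (S.δp T) d t) :
    S.HasDeltaDeriv (fun u => f (S.δp T u)) (d • f') t := by
  have htend := tendsto_δp h ht hd
  rw [hasDeltaDeriv_iff_isLittleO] at *
  -- The chain rule has this simple form because σ commutes with the shift: f is expanded at
  -- σ(δ₊(t)), the inner function at δ₊(σ(t)).
  rw [h.sigma_δp ht] at hf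
  have h1 := hf.comp_tendsto htend
  have hO : (fun u => S.δp T (S.sigma t) - S.δp T u) =O[𝓝[S.sub] t] fun u => S.sigma t - u := by
    have h3 : (fun u => (S.sigma t - u) • d) =O[𝓝[S.sub] t] fun u => S.sigma t - u := by
      simpa [mul_comm] using (isBigO_refl (fun u => S.sigma t - u) (𝓝[S.sub] t)).const_mul_left d
    refine (hd.isBigO.add h3).congr_left fun u => ?_
    abel
  have h4 := h1.trans_isBigO hO
  have h5 : (fun u => (S.δp T (S.sigma t) - S.δp T u - (S.sigma t - u) • d) • f') =o[𝓝[S.sub] t]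
      fun u => S.sigma t - u := by
    have := hd.smul_isBigO (isBigO_refl (fun _ : ℝ => f') (𝓝[S.sub] t))
    refine this.trans_isBigO ?_
    have := (isBigO_refl (fun u => S.sigma t - u) (𝓝[S.sub] t)).smul
      (isBigO_const_const f' (one_ne_zero (α := ℝ)) (𝓝[S.sub] t))
    simpa using this
  refine (h4.add h5).congr_left fun u => ?_
  simp only [Function.comp, sub_smul, smul_smul, smul_eq_mul]
  abel

end HasDeltaDeriv

/-- At a right-scattered t, |σ(t) - u| stays away from 0 as u → t, so it suffices that the remainder
tends to 0. -/
theorem hasDeltaDeriv_of_lt_sigma {f : ℝ → E} {f' : E} {t : ℝ} (hlt : t < S.sigma t)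
    (hc : ContinuousWithinAt f S.sub t) (he : f (S.sigma t) = f t + (S.sigma t - t) • f') :
    S.HasDeltaDeriv f f' t := by
  intro ε hε
  have hid : Tendsto (fun u : ℝ => u) (𝓝[S.sub] t) (𝓝 t) := tendsto_id.mono_left nhdsWithin_le_nhds
  have hlin : Tendsto (fun u : ℝ => S.sigma t - u) (𝓝[S.sub] t) (𝓝 (S.sigma t - t)) :=
    tendsto_const_nhds.sub hid
  have h1 : Tendsto (fun u => ‖f (S.sigma t) - f u - (S.sigma t - u) • f'‖) (𝓝[S.sub] t) (𝓝 0) := by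
    have := ((tendsto_const_nhds (x := f (S.sigma t))).sub hc).sub (hlin.smul_const f')
    rw [he, add_sub_cancel_left, sub_self] at this
    simpa [he] using this.norm
  have h2 := hlin.abs.const_mul ε
  have h3 : 0 < ε * |S.sigma t - t| := mul_pos hε (abs_pos.2 (sub_pos.2 hlt).ne')
  filter_upwards [h1.eventually_lt h2 h3] with u hu using hu.le

/-- A function whose delta derivative vanishes is constant. -/
theorem ShiftPeriodic.eq_of_hasDeltaDeriv_zero (h : S.ShiftPeriodic T) {f : ℝ → E}
    (hf : ∀ t ∈ S.sub, S.HasDeltaDeriv f 0 t) {a b : ℝ} (ha : a ∈ S.sub) (hb : b ∈ S.sub) :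
    f a = f b := by
  have key : ∀ a ∈ S.sub, ∀ b ∈ S.sub, a ≤ b → f a = f b := by
    intro a ha b hb hab
    -- A mean value estimate with arbitrary slope ε, propagated by time scale induction; ε → 0 at
    -- the end.
    have hε : ∀ ε > 0, ‖f b - f a‖ ≤ ε * (b - a) := by
      intro ε hε
      refine h.timeScale_induction (P := fun t => ‖f t - f a‖ ≤ ε * (t - a)) ha hb hab (by simp)
        ?_ ?_ ?_
      · intro t ht hat _ hs hP
        have := (hf t ht).apply_sigma ht
        rw [smul_zero, add_zero] at this
        rw [this]
        exact hP.trans (by gcongr)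
      · intro t ht hat _ hs hP
        have h1 := hf t ht ε hε
        rw [hs] at h1
        obtain ⟨δ, hδ, hδ'⟩ := Metric.eventually_nhds_iff.1 (eventually_nhdsWithin_iff.1 h1)
        refine ⟨t + δ, by linarith, fun v hv htv hvc => ?_⟩
        have h2 := hδ' (y := v) (by rw [Real.dist_eq, abs_of_pos (by linarith)]; linarith) hv
        have h3 : |t - v| = v - t := by rw [abs_sub_comm, abs_of_pos (by linarith)]
        have h4 : ‖f v - f t‖ ≤ ε * (v - t) := by
          rw [norm_sub_rev, ← h3]; simpa using h2
        calc ‖f v - f a‖ ≤ ‖f v - f t‖ + ‖f t - f a‖ := norm_sub_le_norm_sub_add_norm_sub _ _ _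
          _ ≤ ε * (v - t) + ε * (t - a) := add_le_add h4 hP
          _ = ε * (v - a) := by ring
      · intro t ht hat _ hdense hP
        have hc := (hf t ht).continuousWithinAt ht
        have hne : (𝓝[S.sub ∩ Ico a t] t).NeBot := by
          rw [← mem_closure_iff_nhdsWithin_neBot, Metric.mem_closure_iff]
          intro δ hδ
          obtain ⟨v, hv, h1, h2⟩ := hdense (max a (t - δ)) (max_lt hat (by linarith))
          refine ⟨v, ⟨hv, (le_max_left _ _).trans h1.le, h2⟩, ?_⟩
          have := (le_max_right a (t - δ)).trans_lt h1
          rw [Real.dist_eq, abs_of_pos (by linarith)]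
          linarith
        have h1 : Tendsto (fun v => ‖f v - f a‖) (𝓝[S.sub ∩ Ico a t] t) (𝓝 ‖f t - f a‖) :=
          ((hc.mono inter_subset_left).sub_const (f a)).norm
        have h2 : Tendsto (fun v => ε * (v - a)) (𝓝[S.sub ∩ Ico a t] t) (𝓝 (ε * (t - a))) :=
          ((tendsto_id.mono_left nhdsWithin_le_nhds).sub_const a).const_mul ε
        refine le_of_tendsto_of_tendsto h1 h2 ?_
        filter_upwards [self_mem_nhdsWithin] with v hv using hP v hv.1 hv.2.1 hv.2.2
    have h0 : Tendsto (fun ε : ℝ => ε * (b - a)) (𝓝[>] 0) (𝓝 0) := by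
      have : Tendsto (fun ε : ℝ => ε * (b - a)) (𝓝 0) (𝓝 (0 * (b - a))) :=
        tendsto_id.mul_const (b - a)
      rw [zero_mul] at this
      exact this.mono_left nhdsWithin_le_nhds
    have h1 : ‖f b - f a‖ ≤ 0 := ge_of_tendsto h0 (by
      filter_upwards [self_mem_nhdsWithin] with ε hε' using hε ε hε')
    exact (sub_eq_zero.1 (norm_le_zero_iff.1 h1)).symm
  rcases le_total a b with hab | hab
  · exact key a ha b hb hab
  · exact (key b hb a ha hab).symm

/-! ### Rd-continuity at a point -/

/-- Rd-continuity at the point `t`. -/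
def RdAt {X : Type*} [TopologicalSpace X] (S : ShiftTimeScale) (f : ℝ → X) (t : ℝ) : Prop :=
  (S.sigma t = t → ContinuousWithinAt f S.sub t) ∧ ∃ L, Tendsto f (𝓝[S.sub ∩ Iio t] t) (𝓝 L)

section RdAt

variable {X Y Z : Type*} [TopologicalSpace X] [TopologicalSpace Y] [TopologicalSpace Z]

theorem rdAt_of_continuousWithinAt {f : ℝ → X} {t : ℝ} (hf : ContinuousWithinAt f S.sub t) :
    S.RdAt f t :=
  ⟨fun _ => hf, f t, hf.mono_left (nhdsWithin_mono _ inter_subset_left)⟩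

theorem rdContinuous_of_continuousOn {f : ℝ → X} (hf : ContinuousOn f S.sub) : S.RdContinuous f :=
  fun t ht => rdAt_of_continuousWithinAt (hf t ht)

theorem RdContinuous.rdAt {f : ℝ → X} (hf : S.RdContinuous f) {t : ℝ} (ht : t ∈ S.sub) :
    S.RdAt f t := hf t ht

theorem RdAt.congr {f g : ℝ → X} {t : ℝ} (ht : t ∈ S.sub) (hf : S.RdAt f t)
    (hfg : EqOn f g S.sub) : S.RdAt g t := by
  refine ⟨fun e => (hf.1 e).congr (fun u hu => (hfg hu).symm) (hfg ht).symm, ?_⟩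
  obtain ⟨L, hL⟩ := hf.2
  refine ⟨L, hL.congr' ?_⟩
  filter_upwards [self_mem_nhdsWithin] with u hu using hfg hu.1

theorem RdAt.comp₂ {f : ℝ → X} {g : ℝ → Y} {t : ℝ} (hf : S.RdAt f t) (hg : S.RdAt g t)
    {b : X → Y → Z} (hb : Continuous fun p : X × Y => b p.1 p.2) :
    S.RdAt (fun u => b (f u) (g u)) t := by
  obtain ⟨L, hL⟩ := hf.2
  obtain ⟨M, hM⟩ := hg.2
  exact ⟨fun e => (hb.tendsto (f t, g t)).comp ((hf.1 e).prodMk_nhds (hg.1 e)), b L M,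
    (hb.tendsto (L, M)).comp (hL.prodMk_nhds hM)⟩

theorem RdContinuous.congr {f g : ℝ → X} (hf : S.RdContinuous f) (hfg : EqOn f g S.sub) :
    S.RdContinuous g := fun t ht => RdAt.congr ht (hf t ht) hfg

theorem RdContinuous.comp₂ {f : ℝ → X} {g : ℝ → Y} (hf : S.RdContinuous f) (hg : S.RdContinuous g)
    {b : X → Y → Z} (hb : Continuous fun p : X × Y => b p.1 p.2) :
    S.RdContinuous fun u => b (f u) (g u) := fun t ht => RdAt.comp₂ (hf t ht) (hg t ht) hb

/-- `hlt` sends approach from the left to approach from the left, and `hσ` sends right-dense points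
to right-dense points; each preserves one half of rd-continuity. -/
theorem RdAt.comp_tendsto {f : ℝ → X} {g : ℝ → ℝ} {t : ℝ} (hf : S.RdAt f (g t))
    (hg : Tendsto g (𝓝[S.sub] t) (𝓝[S.sub] (g t)))
    (hlt : ∀ u ∈ S.sub, u < t → g u < g t) (hσ : S.sigma t = t → S.sigma (g t) = g t) :
    S.RdAt (fun u => f (g u)) t := by
  refine ⟨fun e => (hf.1 (hσ e)).tendsto.comp hg, ?_⟩
  obtain ⟨L, hL⟩ := hf.2
  refine ⟨L, hL.comp (tendsto_nhdsWithin_iff.2 ⟨?_, ?_⟩)⟩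
  · exact (hg.mono_left (nhdsWithin_mono _ inter_subset_left)).mono_right nhdsWithin_le_nhds
  · filter_upwards [self_mem_nhdsWithin,
      (hg.mono_left (nhdsWithin_mono _ inter_subset_left)).eventually self_mem_nhdsWithin]
      with u hu hu'
    exact ⟨hu', hlt u hu.1 hu.2⟩

theorem RdAt.comp_δp (h : S.ShiftPeriodic T) {f : ℝ → X} {d t : ℝ} (ht : t ∈ S.sub)
    (hd : S.HasDeltaDeriv (S.δp T) d t) (hf : S.RdAt f (S.δp T t)) :
    S.RdAt (fun u => f (S.δp T u)) t :=
  hf.comp_tendsto (HasDeltaDeriv.tendsto_δp h ht hd) (fun u hu hut => h.δp_lt hu ht hut)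
    fun e => by rw [h.sigma_δp ht, e]

/-- A continuous function of `σ` is rd-continuous. -/
theorem rdContinuous_comp_sigma (h : S.ShiftPeriodic T) {f : ℝ → X} (hf : ContinuousOn f S.sub) :
    S.RdContinuous fun u => f (S.sigma u) := by
  intro t ht
  refine ⟨fun e => ?_, f t, ?_⟩
  · have : Tendsto S.sigma (𝓝[S.sub] t) (𝓝[S.sub] t) := by
      refine tendsto_nhdsWithin_iff.2 ⟨?_, eventually_mem_nhdsWithin.mono fun u hu =>
        h.sigma_mem hu⟩
      rw [tendsto_order]
      constructor
      · intro a ha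
        filter_upwards [self_mem_nhdsWithin, nhdsWithin_le_nhds (Ioi_mem_nhds ha)] with u hu hau
        exact (mem_Ioi.1 hau).trans_le (h.le_sigma hu)
      · intro c hc
        obtain ⟨v, hv, htv, hvc⟩ := h.exists_lt_of_sigma_lt ht (e.trans_lt hc)
        filter_upwards [self_mem_nhdsWithin, nhdsWithin_le_nhds (Iio_mem_nhds htv)] with u hu huv
        exact (h.sigma_le hu hv huv).trans_lt hvc
    have h2 := (hf t ht).tendsto.comp this
    rw [ContinuousWithinAt, e]
    exact h2
  -- For u < t one has u ≤ σ(u) ≤ t, so the left limit is f(t), even where σ(t) > t.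
  · have : Tendsto S.sigma (𝓝[S.sub ∩ Iio t] t) (𝓝[S.sub] t) := by
      refine tendsto_nhdsWithin_iff.2 ⟨?_, eventually_mem_nhdsWithin.mono fun u hu =>
        h.sigma_mem hu.1⟩
      refine tendsto_of_tendsto_of_tendsto_of_le_of_le'
        (tendsto_id.mono_left nhdsWithin_le_nhds) tendsto_const_nhds ?_ ?_
      · filter_upwards [self_mem_nhdsWithin] with u hu using h.le_sigma hu.1
      · filter_upwards [self_mem_nhdsWithin] with u hu using h.sigma_le hu.1 (S.sub_subset ht) hu.2
    exact (hf t ht).tendsto.comp this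

end RdAt

/-! ### The delta integral -/

/-- Compactness reduces this to local bounds. Near a right-scattered t the only points are t and
points to its left, where the left limit gives the bound. -/
theorem RdContinuous.exists_bound {E : Type*} [NormedAddCommGroup E] (h : S.ShiftPeriodic T)
    {f : ℝ → E} (hf : S.RdContinuous f)
    {a b : ℝ} (ha : a ∈ S.sub) (hb : b ∈ S.sub) :
    ∃ C, 0 ≤ C ∧ ∀ t ∈ S.carrier ∩ Icc a b, ‖f t‖ ≤ C := by
  suffices H : ∃ C, ∀ t ∈ S.carrier ∩ Icc a b, ‖f t‖ ≤ C by
    obtain ⟨C, hC⟩ := H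
    exact ⟨max C 0, le_max_right _ _, fun t ht => (hC t ht).trans (le_max_left _ _)⟩
  refine (S.isCompact_inter_Icc a b).induction_on (p := fun s => ∃ C, ∀ t ∈ s, ‖f t‖ ≤ C)
    ⟨0, by simp⟩ ?_ ?_ ?_
  · rintro s t hst ⟨C, hC⟩
    exact ⟨C, fun x hx => hC x (hst hx)⟩
  · rintro s t ⟨C, hC⟩ ⟨D, hD⟩
    refine ⟨max C D, fun x hx => ?_⟩
    rcases hx with hx | hx
    · exact (hC x hx).trans (le_max_left _ _)
    · exact (hD x hx).trans (le_max_right _ _)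
  · intro t htK
    have ht := h.convex a ha b hb htK
    have hsub := h.convex a ha b hb
    rcases (h.le_sigma ht).eq_or_lt with e | hlt
    · have hc := ((hf t ht).1 e.symm).norm
      refine ⟨{u | ‖f u‖ < ‖f t‖ + 1}, ?_, ‖f t‖ + 1, fun u hu => le_of_lt hu⟩
      exact nhdsWithin_mono _ hsub (hc.tendsto.eventually_lt_const (lt_add_one _))
    · obtain ⟨L, hL⟩ := (hf t ht).2
      have h1 : ∀ᶠ u in 𝓝[S.sub ∩ Iio t] t, ‖f u‖ < ‖L‖ + 1 :=
        hL.norm.eventually_lt_const (lt_add_one _)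
      refine ⟨{u | ‖f u‖ ≤ max (‖f t‖) (‖L‖ + 1)}, ?_, _, fun u hu => hu⟩
      refine nhdsWithin_mono _ hsub ?_
      rw [eventually_nhdsWithin_iff] at h1
      refine eventually_nhdsWithin_iff.2 ?_
      filter_upwards [h1, Iio_mem_nhds hlt] with u hu hus husub
      rcases (h.le_of_lt_sigma ht (S.sub_subset husub) hus).eq_or_lt with e | hut
      · rw [e]
        exact le_max_left _ _
      · exact (hu ⟨husub, hut⟩).le.trans (le_max_right _ _)

theorem ShiftPeriodic.countable_lt_sigma (h : S.ShiftPeriodic T) :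
    {t | t ∈ S.sub ∧ t < S.sigma t}.Countable := by
  refine (countable_setOfPred_isolated_right_within (s := S.carrier)).mono fun t ht => ?_
  refine ⟨S.sub_subset ht.1, ?_⟩
  rw [← empty_mem_iff_bot, mem_nhdsWithin]
  refine ⟨Iio (S.sigma t), isOpen_Iio, ht.2, fun u hu => ?_⟩
  exact absurd (h.le_of_lt_sigma ht.1 hu.2.1 hu.1) (not_le.2 hu.2.2)

/-- On [a, b] the function f is continuous off the countable set of right-scattered points, hence
Borel; `floor` is monotone there, so the composition is measurable, and it is bounded. -/
theorem RdContinuous.intervalIntegrable [FiniteDimensional ℝ E] (h : S.ShiftPeriodic T)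
    {f : ℝ → E} (hf : S.RdContinuous f)
    {a b : ℝ} (ha : a ∈ S.sub) (hb : b ∈ S.sub) :
    IntervalIntegrable (fun x => f (S.floor x)) volume a b := by
  wlog hab : a ≤ b generalizing a b
  · exact (this hb ha (le_of_not_ge hab)).symm
  borelize E
  have : ProperSpace E := FiniteDimensional.proper ℝ E
  have hac := S.sub_subset ha
  rw [intervalIntegrable_iff_integrableOn_Ioc_of_le hab]
  obtain ⟨C, -, hC⟩ := hf.exists_bound h ha hb
  refine IntegrableOn.of_bound measure_Ioc_lt_top ?_ C ?_
  · set K := S.carrier ∩ Icc a b with hK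
    set R := {t | t ∈ S.sub ∧ t < S.sigma t} with hR
    have hKm : MeasurableSet K := (S.isCompact_inter_Icc a b).isClosed.measurableSet
    have hRm : MeasurableSet R := h.countable_lt_sigma.measurableSet
    classical
    have h1 : Measurable ((K \ R).piecewise f 0) := by
      refine ContinuousOn.measurable_piecewise ?_ continuousOn_const (hKm.diff hRm)
      intro t ht
      have hts := h.convex a ha b hb ht.1
      have e : S.sigma t = t := by
        by_contra hne
        exact ht.2 ⟨hts, lt_of_le_of_ne (h.le_sigma hts) (Ne.symm hne)⟩
      exact ((hf t hts).1 e).mono fun u hu => h.convex a ha b hb hu.1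
    have h2 : Measurable (K.piecewise f 0) := by
      refine h1.measurable_of_countable_ne (h.countable_lt_sigma.mono fun t ht => ?_)
      by_contra htR
      apply ht
      by_cases htK : t ∈ K
      · rw [piecewise_eq_of_mem _ _ _ (show t ∈ K \ R from ⟨htK, htR⟩),
          piecewise_eq_of_mem _ _ _ htK]
      · rw [piecewise_eq_of_notMem _ _ _ (show t ∉ K \ R from fun h => htK h.1),
          piecewise_eq_of_notMem _ _ _ htK]
    have h3 : AEMeasurable S.floor (volume.restrict (Ioc a b)) :=
      aemeasurable_restrict_of_monotoneOn measurableSet_Ioc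
        fun x hx y _ hxy => floor_mono hac hx.1.le hxy
    have h4 := (h2.comp_aemeasurable h3).aestronglyMeasurable
    refine h4.congr ?_
    filter_upwards [ae_restrict_mem measurableSet_Ioc] with x hx
    refine piecewise_eq_of_mem _ _ _ ⟨floor_mem hac hx.1.le, le_floor hac hx.1.le,
      (floor_le hac hx.1.le).trans hx.2⟩
  · filter_upwards [ae_restrict_mem measurableSet_Ioc] with x hx
    exact hC _ ⟨floor_mem hac hx.1.le, le_floor hac hx.1.le, (floor_le hac hx.1.le).trans hx.2⟩

theorem RdContinuous.deltaIntegral_add [FiniteDimensional ℝ E] (h : S.ShiftPeriodic T)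
    {f : ℝ → E} (hf : S.RdContinuous f)
    {a b c : ℝ} (ha : a ∈ S.sub) (hb : b ∈ S.sub) (hc : c ∈ S.sub) :
    S.deltaIntegral f a b + S.deltaIntegral f b c = S.deltaIntegral f a c :=
  intervalIntegral.integral_add_adjacent_intervals (hf.intervalIntegrable h ha hb)
    (hf.intervalIntegrable h hb hc)

theorem deltaIntegral_self (f : ℝ → E) (a : ℝ) : S.deltaIntegral f a a = 0 :=
  intervalIntegral.integral_same

theorem ShiftPeriodic.norm_deltaIntegral_le (h : S.ShiftPeriodic T) {f : ℝ → E} {a b C : ℝ}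
    (ha : a ∈ S.sub) (hb : b ∈ S.sub)
    (hC : ∀ t ∈ S.sub, min a b ≤ t → t ≤ max a b → ‖f t‖ ≤ C) :
    ‖S.deltaIntegral f a b‖ ≤ C * |b - a| := by
  refine intervalIntegral.norm_integral_le_of_norm_le_const fun x hx => ?_
  have hmin : min a b ∈ S.sub := by rcases min_choice a b with e | e <;> rw [e] <;> assumption
  have hmax : max a b ∈ S.sub := by rcases max_choice a b with e | e <;> rw [e] <;> assumption
  have hc := S.sub_subset hmin
  exact hC _ (h.floor_mem_sub hmin hmax hx.1.le hx.2) (le_floor hc hx.1.le)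
    ((floor_le hc hx.1.le).trans hx.2)

theorem ShiftPeriodic.deltaIntegral_sigma [CompleteSpace E] (h : S.ShiftPeriodic T)
    (f : ℝ → E) {t : ℝ}
    (ht : t ∈ S.sub) : S.deltaIntegral f t (S.sigma t) = (S.sigma t - t) • f t := by
  have h1 : EqOn (fun x => f (S.floor x)) (fun _ => f t) (uIoo t (S.sigma t)) := by
    intro x hx
    rw [uIoo_of_le (h.le_sigma ht)] at hx
    exact congrArg f (h.floor_eq ht hx.1.le hx.2)
  rw [deltaIntegral, intervalIntegral.integral_congr_uIoo h1, intervalIntegral.integral_const]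

theorem RdContinuous.deltaIntegral_sub [FiniteDimensional ℝ E] {f g : ℝ → E} (h : S.ShiftPeriodic T)
    (hf : S.RdContinuous f) (hg : S.RdContinuous g)
    {a b : ℝ} (ha : a ∈ S.sub) (hb : b ∈ S.sub) :
    S.deltaIntegral (fun t => f t - g t) a b = S.deltaIntegral f a b - S.deltaIntegral g a b :=
  intervalIntegral.integral_sub (hf.intervalIntegrable h ha hb) (hg.intervalIntegrable h ha hb)

theorem RdContinuous.deltaIntegral_clm [FiniteDimensional ℝ E] [FiniteDimensional ℝ F]
    {f : ℝ → E} (h : S.ShiftPeriodic T)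
    (hf : S.RdContinuous f) (L : E →L[ℝ] F) {a b : ℝ} (ha : a ∈ S.sub) (hb : b ∈ S.sub) :
    S.deltaIntegral (fun t => L (f t)) a b = L (S.deltaIntegral f a b) := by
  have := FiniteDimensional.complete ℝ E
  have := FiniteDimensional.complete ℝ F
  exact L.intervalIntegral_comp_comm (hf.intervalIntegrable h ha hb)

/-- The fundamental theorem of calculus for the delta integral. -/
theorem RdContinuous.hasDeltaDeriv_deltaIntegral [FiniteDimensional ℝ E] (h : S.ShiftPeriodic T)
    {f : ℝ → E} (hf : S.RdContinuous f) {a t : ℝ} (ha : a ∈ S.sub) (ht : t ∈ S.sub) :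
    S.HasDeltaDeriv (fun u => S.deltaIntegral f a u) (f t) t := by
  have hdiff : ∀ u ∈ S.sub, ∀ v ∈ S.sub,
      S.deltaIntegral f a v - S.deltaIntegral f a u = S.deltaIntegral f u v := fun u hu v hv => by
    rw [← hf.deltaIntegral_add h ha hu hv, add_sub_cancel_left]
  have hst := h.sigma_mem ht
  have := FiniteDimensional.complete ℝ E
  rcases (h.le_sigma ht).eq_or_lt with e | hlt
  · intro ε hε
    have hc := (hf t ht).1 e.symm
    obtain ⟨δ, hδ, hball⟩ := Metric.continuousWithinAt_iff.1 hc ε hε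
    have hmem : Metric.ball t δ ∈ 𝓝[S.sub] t := nhdsWithin_le_nhds (Metric.ball_mem_nhds t hδ)
    filter_upwards [self_mem_nhdsWithin, hmem] with u hu hut
    rw [← e, hdiff u hu t ht]
    have h1 : (t - u) • f t = S.deltaIntegral (fun _ => f t) u t := by simp [deltaIntegral]
    have hconst : S.RdContinuous fun _ : ℝ => f t := rdContinuous_of_continuousOn continuousOn_const
    rw [h1, ← hf.deltaIntegral_sub h hconst hu ht]
    refine h.norm_deltaIntegral_le hu ht fun v hv h1 h2 => ?_
    rw [← dist_eq_norm]
    refine (hball hv ?_).le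
    refine lt_of_le_of_lt ?_ (Metric.mem_ball.1 hut)
    rw [Real.dist_eq, Real.dist_eq]
    rcases le_total u t with hle | hle
    · rw [min_eq_left hle] at h1
      rw [max_eq_right hle] at h2
      rw [abs_of_nonpos (by linarith), abs_of_nonpos (by linarith)]
      linarith
    · rw [min_eq_right hle] at h1
      rw [max_eq_left hle] at h2
      rw [abs_of_nonneg (by linarith), abs_of_nonneg (by linarith)]
      linarith
  · refine hasDeltaDeriv_of_lt_sigma hlt ?_ ?_
    -- Continuity at a right-scattered point: f is bounded between δ₋(t) and σ(t), so the integral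
    -- is Lipschitz near t. The jump across the gap is computed exactly below.
    · have hm := h.δm_mem ht
      obtain ⟨C, hC0, hC⟩ := hf.exists_bound h hm hst
      refine tendsto_iff_norm_sub_tendsto_zero.2 ?_
      have hlin : Tendsto (fun u : ℝ => C * |u - t|) (𝓝[S.sub] t) (𝓝 0) := by
        have h1 : Continuous fun u : ℝ => C * |u - t| := by fun_prop
        have := h1.tendsto t
        simp only [sub_self, abs_zero, mul_zero] at this
        exact this.mono_left nhdsWithin_le_nhds
      refine squeeze_zero' (Eventually.of_forall fun _ => norm_nonneg _) ?_ hlin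
      filter_upwards [self_mem_nhdsWithin, nhdsWithin_le_nhds (Ioi_mem_nhds (h.δm_lt_self ht)),
        nhdsWithin_le_nhds (Iio_mem_nhds hlt)] with u hu h1 h2
      rw [hdiff t ht u hu]
      refine h.norm_deltaIntegral_le ht hu fun v hv h3 h4 => hC v ⟨S.sub_subset hv, ?_, ?_⟩
      · exact (le_min (h.δm_lt_self ht).le (le_of_lt h1)).trans h3
      · exact h4.trans (max_le hlt.le (le_of_lt h2))
    · rw [← h.deltaIntegral_sigma f ht, hf.deltaIntegral_add h ha ht hst]

theorem RdContinuous.continuousOn_deltaIntegral [FiniteDimensional ℝ E] (h : S.ShiftPeriodic T)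
    {f : ℝ → E} (hf : S.RdContinuous f) {a : ℝ} (ha : a ∈ S.sub) :
    ContinuousOn (fun u => S.deltaIntegral f a u) S.sub :=
  fun _ ht => (hf.hasDeltaDeriv_deltaIntegral h ha ht).continuousWithinAt ht

theorem ShiftPeriodic.sub_eq_deltaIntegral [FiniteDimensional ℝ E] (h : S.ShiftPeriodic T)
    {f g : ℝ → E} (hg : S.RdContinuous g) (hf : ∀ t ∈ S.sub, S.HasDeltaDeriv f (g t) t) {a b : ℝ}
    (ha : a ∈ S.sub) (hb : b ∈ S.sub) : f b - f a = S.deltaIntegral g a b := by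
  have h1 := h.eq_of_hasDeltaDeriv_zero (f := fun u => f u - S.deltaIntegral g a u)
    (fun t ht => by simpa using (hf t ht).sub (hg.hasDeltaDeriv_deltaIntegral h ha ht)) ha hb
  simp only [deltaIntegral_self, sub_zero] at h1
  rw [h1]
  abel

/-- Substitution of a shift in a delta integral. -/
theorem ShiftPeriodic.deltaIntegral_comp_δp [FiniteDimensional ℝ E] (h : S.ShiftPeriodic T)
    (hd : ∀ t ∈ S.sub, ∃ d, S.HasDeltaDeriv (S.δp T) d t) {f g : ℝ → E}
    (hf : S.RdContinuous f) (hg : S.RdContinuous g)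
    (hfg : ∀ t ∈ S.sub, S.deltaDeriv (S.δp T) t • f (S.δp T t) = g t)
    {a b : ℝ} (ha : a ∈ S.sub) (hb : b ∈ S.sub) :
    S.deltaIntegral f (S.δp T a) (S.δp T b) = S.deltaIntegral g a b := by
  -- The substitution rule follows by differentiating in the upper limit, with no change of
  -- variables for the measure.
  have h1 := h.sub_eq_deltaIntegral (f := fun u => S.deltaIntegral f (S.δp T a) (S.δp T u)) hg
    (fun t ht => by
      rw [← hfg t ht]
      exact (hf.hasDeltaDeriv_deltaIntegral h (h.δp_mem ha) (h.δp_mem ht)).comp_δp h ht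
        (hasDeltaDeriv_deltaDeriv (hd t ht))) ha hb
  simpa [deltaIntegral_self] using h1

end ShiftTimeScale

namespace ShiftTimeScale

open MeasureTheory

attribute [local instance] Matrix.linftyOpNormedRing Matrix.linftyOpNormedAlgebra

variable {S : ShiftTimeScale} {T : ℝ} {n : ℕ} {A : ℝ → Matrix (Fin n) (Fin n) ℝ}

/-! ### The Peano-Baker series -/

theorem RdContinuous.mulVec {z : ℝ → Fin n → ℝ} (hA : S.RdContinuous A) (hz : S.RdContinuous z) :
    S.RdContinuous fun u => (A u).mulVec (z u) :=
  hA.comp₂ hz (continuous_fst.matrix_mulVec continuous_snd)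

theorem RdContinuous.matrix_mul {B : ℝ → Matrix (Fin n) (Fin n) ℝ} (hA : S.RdContinuous A)
    (hB : S.RdContinuous B) : S.RdContinuous fun u => A u * B u :=
  hA.comp₂ hB (continuous_fst.matrix_mul continuous_snd)

theorem of_deltaIntegral_eq (h : S.ShiftPeriodic T) {F : ℝ → Matrix (Fin n) (Fin n) ℝ}
    (hF : S.RdContinuous F) {a b : ℝ} (ha : a ∈ S.sub) (hb : b ∈ S.sub) :
    Matrix.of (fun i j => S.deltaIntegral (fun τ => F τ i j) a b) = S.deltaIntegral F a b := by
  ext i j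
  exact hF.deltaIntegral_clm h (LinearMap.toContinuousLinearMap (Matrix.entryLinearMap ℝ ℝ i j))
    ha hb

theorem continuousOn_peanoBaker (h : S.ShiftPeriodic T) (hA : S.RdContinuous A) {s : ℝ}
    (hs : s ∈ S.sub) (k : ℕ) : ContinuousOn (S.peanoBaker A s k) S.sub := by
  induction k with
  | zero => exact continuousOn_const (c := 1)
  | succ k ih =>
    have hF := hA.matrix_mul (rdContinuous_of_continuousOn ih)
    exact (hF.continuousOn_deltaIntegral h hs).congr fun t ht => of_deltaIntegral_eq h hF hs ht

theorem peanoBaker_succ (h : S.ShiftPeriodic T) (hA : S.RdContinuous A) {s t : ℝ}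
    (hs : s ∈ S.sub) (ht : t ∈ S.sub) (k : ℕ) : S.peanoBaker A s (k + 1) t =
      S.deltaIntegral (fun τ => A τ * S.peanoBaker A s k τ) s t :=
  of_deltaIntegral_eq h (hA.matrix_mul (rdContinuous_of_continuousOn
    (continuousOn_peanoBaker h hA hs k))) hs ht

/-- The classical factorial bound survives because `floor` x ≤ x: the extended integrand is
dominated by a multiple of (x - s)^k, which is integrated as an ordinary power. The factor ‖1‖ is
kept since it vanishes for n = 0. -/
theorem norm_peanoBaker_le (h : S.ShiftPeriodic T) (hA : S.RdContinuous A) {s b M : ℝ}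
    (hs : s ∈ S.sub) (hb : b ∈ S.sub) (hM0 : 0 ≤ M) (hM : ∀ t ∈ S.carrier ∩ Icc s b, ‖A t‖ ≤ M)
    (k : ℕ) : ∀ t ∈ S.carrier ∩ Icc s b, ‖S.peanoBaker A s k t‖ ≤
      ‖(1 : Matrix (Fin n) (Fin n) ℝ)‖ * ((M * (t - s)) ^ k / k.factorial) := by
  induction k with
  | zero => intro t _; simp [peanoBaker]
  | succ k ih =>
    intro t ht
    have hts := h.convex s hs b hb ht
    have hsc := S.sub_subset hs
    rw [peanoBaker_succ h hA hs hts]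
    set c : ℝ := ‖(1 : Matrix (Fin n) (Fin n) ℝ)‖ * (M ^ (k + 1) / k.factorial) with hc
    have h1 : ‖S.deltaIntegral (fun τ => A τ * S.peanoBaker A s k τ) s t‖ ≤
        ∫ x in s..t, c * (x - s) ^ k := by
      refine intervalIntegral.norm_integral_le_of_norm_le ht.2.1 (ae_of_all _ fun x hx => ?_)
        (by apply Continuous.intervalIntegrable; fun_prop)
      have hfl : S.floor x ∈ S.carrier ∩ Icc s b := ⟨floor_mem hsc hx.1.le, le_floor hsc hx.1.le,
        (floor_le hsc hx.1.le).trans (hx.2.trans ht.2.2)⟩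
      have h0 : 0 ≤ S.floor x - s := sub_nonneg.2 hfl.2.1
      calc ‖A (S.floor x) * S.peanoBaker A s k (S.floor x)‖
          ≤ ‖A (S.floor x)‖ * ‖S.peanoBaker A s k (S.floor x)‖ := norm_mul_le _ _
        _ ≤ M * (‖(1 : Matrix (Fin n) (Fin n) ℝ)‖ * ((M * (x - s)) ^ k / k.factorial)) := by
          refine mul_le_mul (hM _ hfl) ((ih _ hfl).trans ?_) (norm_nonneg _) hM0
          have := floor_le hsc hx.1.le
          gcongr
        _ = c * (x - s) ^ k := by rw [hc, mul_pow]; ring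
    refine h1.trans_eq ?_
    rw [intervalIntegral.integral_const_mul,
      intervalIntegral.integral_comp_sub_right (fun x => x ^ k) s, integral_pow, hc,
      Nat.factorial_succ]
    have : (k.factorial : ℝ) ≠ 0 := by positivity
    push_cast
    rw [mul_pow, sub_self, zero_pow (Nat.succ_ne_zero k), sub_zero]
    field_simp

/-- The sum of the Peano-Baker series, extended by a constant to the left of `s`. -/
noncomputable def fundamental (S : ShiftTimeScale) (A : ℝ → Matrix (Fin n) (Fin n) ℝ) (s t : ℝ) :
    Matrix (Fin n) (Fin n) ℝ := ∑' k, S.peanoBaker A s k (max s t)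

theorem summable_peanoBaker_bound (c x : ℝ) :
    Summable fun k : ℕ => c * (x ^ k / k.factorial) :=
  (Real.summable_pow_div_factorial x).mul_left c

theorem hasSum_peanoBaker (h : S.ShiftPeriodic T) (hA : S.RdContinuous A) {s t : ℝ}
    (hs : s ∈ S.sub) (ht : t ∈ S.sub) (hst : s ≤ t) :
    HasSum (fun k => S.peanoBaker A s k t) (S.fundamental A s t) := by
  obtain ⟨M, hM0, hM⟩ := hA.exists_bound h hs ht
  rw [fundamental, max_eq_right hst]
  exact (Summable.of_norm_bounded (summable_peanoBaker_bound _ _) fun k =>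
    norm_peanoBaker_le h hA hs ht hM0 hM k t ⟨S.sub_subset ht, hst, le_rfl⟩).hasSum

theorem continuousOn_fundamental (h : S.ShiftPeriodic T) (hA : S.RdContinuous A) {s : ℝ}
    (hs : s ∈ S.sub) : ContinuousOn (S.fundamental A s) S.sub := by
  have h1 : ContinuousOn (fun t => ∑' k, S.peanoBaker A s k t) (S.sub ∩ Ici s) := by
    intro t ht
    have hb := h.δp_mem ht.1
    obtain ⟨M, hM0, hM⟩ := hA.exists_bound h hs hb
    -- Weierstrass test on a bounded interval; its right end δ₊(t) lies strictly beyond t, so it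
    -- covers a neighbourhood of t in [s, ∞).
    have h2 : ContinuousOn (fun t => ∑' k, S.peanoBaker A s k t) (S.sub ∩ Icc s (S.δp T t)) := by
      refine continuousOn_tsum (fun k => (continuousOn_peanoBaker h hA hs k).mono inter_subset_left)
        (summable_peanoBaker_bound ‖(1 : Matrix (Fin n) (Fin n) ℝ)‖ (M * (S.δp T t - s)))
        fun k x hx => ?_
      refine (norm_peanoBaker_le h hA hs hb hM0 hM k x ⟨S.sub_subset hx.1, hx.2⟩).trans ?_
      have h3 := sub_nonneg.2 hx.2.1
      have h4 := hx.2.2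
      gcongr
    refine (h2 t ⟨ht.1, ht.2, (h.lt_δp ht.1).le⟩).mono_of_mem_nhdsWithin ?_
    filter_upwards [self_mem_nhdsWithin, nhdsWithin_le_nhds (Iio_mem_nhds (h.lt_δp ht.1))]
      with u hu hu2 using ⟨hu.1, hu.2, le_of_lt hu2⟩
  refine h1.comp (continuous_const.max continuous_id).continuousOn fun t ht =>
    ⟨?_, mem_Ici.2 (le_max_left _ _)⟩
  rcases max_choice s t with e | e <;> simp only [e] <;> assumption

theorem fundamental_self (h : S.ShiftPeriodic T) (hA : S.RdContinuous A) {s : ℝ}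
    (hs : s ∈ S.sub) : S.fundamental A s s = 1 := by
  refine (hasSum_peanoBaker h hA hs hs le_rfl).unique ?_
  refine hasSum_single (f := fun k => S.peanoBaker A s k s) 0 fun k hk => ?_
  obtain ⟨k, rfl⟩ := Nat.exists_eq_succ_of_ne_zero hk
  simp only [Nat.succ_eq_add_one]
  rw [peanoBaker_succ h hA hs hs, deltaIntegral_self]

/-- Termwise integration by dominated convergence, with the factorial bounds as summable majorants.
-/
theorem hasSum_peanoBaker_succ (h : S.ShiftPeriodic T) (hA : S.RdContinuous A) {s t : ℝ}
    (hs : s ∈ S.sub) (ht : t ∈ S.sub) (hst : s ≤ t) :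
    HasSum (fun k => S.peanoBaker A s (k + 1) t)
      (S.deltaIntegral (fun τ => A τ * S.fundamental A s τ) s t) := by
  obtain ⟨M, hM0, hM⟩ := hA.exists_bound h hs ht
  have hsc := S.sub_subset hs
  simp only [peanoBaker_succ h hA hs ht]
  refine intervalIntegral.hasSum_integral_of_dominated_convergence
    (F := fun k x => A (S.floor x) * S.peanoBaker A s k (S.floor x))
    (f := fun x => A (S.floor x) * S.fundamental A s (S.floor x))
    (fun k _ => M * (‖(1 : Matrix (Fin n) (Fin n) ℝ)‖ * ((M * (t - s)) ^ k / k.factorial)))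
    (fun k => ?_) (fun k => ae_of_all _ fun x hx => ?_) (ae_of_all _ fun x _ => ?_) ?_
    (ae_of_all _ fun x hx => ?_)
  · have := (hA.matrix_mul (rdContinuous_of_continuousOn
      (continuousOn_peanoBaker h hA hs k))).intervalIntegrable h hs ht
    rw [uIoc_of_le hst]
    exact this.1.aestronglyMeasurable
  · rw [uIoc_of_le hst] at hx
    have hfl : S.floor x ∈ S.carrier ∩ Icc s t := ⟨floor_mem hsc hx.1.le, le_floor hsc hx.1.le,
      (floor_le hsc hx.1.le).trans hx.2⟩
    have h0 : 0 ≤ S.floor x - s := sub_nonneg.2 hfl.2.1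
    refine (norm_mul_le _ _).trans (mul_le_mul (hM _ hfl)
      ((norm_peanoBaker_le h hA hs ht hM0 hM k _ hfl).trans ?_) (norm_nonneg _) hM0)
    have := hfl.2.2
    gcongr
  · exact (summable_peanoBaker_bound _ _).mul_left M
  · exact intervalIntegrable_const
  · rw [uIoc_of_le hst] at hx
    exact (hasSum_peanoBaker h hA hs (h.floor_mem_sub hs ht hx.1.le hx.2)
      (le_floor hsc hx.1.le)).mul_left _

theorem hasSum_eq_zero_add {E : Type*} [NormedAddCommGroup E] {p : ℕ → E} {a b : E}
    (hp : HasSum p a) (hb : HasSum (fun k => p (k + 1)) b) : a = p 0 + b := by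
  rw [add_comm]
  refine hp.unique ?_
  simpa using (hasSum_nat_add_iff 1).1 hb

theorem fundamental_eq (h : S.ShiftPeriodic T) (hA : S.RdContinuous A) {s t : ℝ}
    (hs : s ∈ S.sub) (ht : t ∈ S.sub) (hst : s ≤ t) : S.fundamental A s t =
      1 + S.deltaIntegral (fun τ => A τ * S.fundamental A s τ) s t := by
  exact hasSum_eq_zero_add (p := fun k => S.peanoBaker A s k t) (hasSum_peanoBaker h hA hs ht hst)
    (hasSum_peanoBaker_succ h hA hs ht hst)

/-! ### Solutions of the integral equation -/

/-- The function `z` solves `z^Δ = A z` on `[a, ∞)`, in integrated form. -/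
structure IsIntegralSolution (S : ShiftTimeScale) (A : ℝ → Matrix (Fin n) (Fin n) ℝ) (a : ℝ)
    (z : ℝ → Fin n → ℝ) : Prop where
  continuousOn : ContinuousOn z S.sub
  eq : ∀ t ∈ S.sub, a ≤ t → z t - z a = S.deltaIntegral (fun u => (A u).mulVec (z u)) a t

namespace IsIntegralSolution

variable {a : ℝ} {z w : ℝ → Fin n → ℝ}

theorem sub_eq (h : S.ShiftPeriodic T) (hA : S.RdContinuous A) (ha : a ∈ S.sub)
    (hz : S.IsIntegralSolution A a z) {u v : ℝ} (hu : u ∈ S.sub) (hv : v ∈ S.sub) (hau : a ≤ u)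
    (hav : a ≤ v) : z v - z u = S.deltaIntegral (fun u => (A u).mulVec (z u)) u v := by
  have h1 := (hA.mulVec (rdContinuous_of_continuousOn hz.continuousOn)).deltaIntegral_add h ha hu hv
  rw [← hz.eq u hu hau, ← hz.eq v hv hav] at h1
  rw [eq_sub_of_add_eq' h1]
  abel

theorem mono (h : S.ShiftPeriodic T) (hA : S.RdContinuous A) (ha : a ∈ S.sub)
    (hz : S.IsIntegralSolution A a z) {b : ℝ} (hb : b ∈ S.sub) (hab : a ≤ b) :
    S.IsIntegralSolution A b z :=
  ⟨hz.continuousOn, fun _ ht hbt => hz.sub_eq h hA ha hb ht hab (hab.trans hbt)⟩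

theorem sub (h : S.ShiftPeriodic T) (hA : S.RdContinuous A) (ha : a ∈ S.sub)
    (hz : S.IsIntegralSolution A a z) (hw : S.IsIntegralSolution A a w) :
    S.IsIntegralSolution A a fun t => z t - w t := by
  refine ⟨hz.continuousOn.sub hw.continuousOn, fun t ht hat => ?_⟩
  simp only [Matrix.mulVec_sub]
  rw [(hA.mulVec (rdContinuous_of_continuousOn hz.continuousOn)).deltaIntegral_sub h
    (hA.mulVec (rdContinuous_of_continuousOn hw.continuousOn)) ha ht, ← hz.eq t ht hat,
    ← hw.eq t ht hat]
  abel

/-- At a point m where ‖z‖ is maximal, integrating from the zero c gives ‖z m‖ ≤ M (t - v) ‖z m‖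
with factor below 1. The zero may lie on either side of m, so uniqueness holds forwards and
backwards. -/
theorem eq_zero_of_short (h : S.ShiftPeriodic T) (hA : S.RdContinuous A) (ha : a ∈ S.sub)
    (hz : S.IsIntegralSolution A a z) {v t M : ℝ} (hv : v ∈ S.sub) (ht : t ∈ S.sub) (hav : a ≤ v)
    (hM0 : 0 ≤ M) (hM : ∀ u ∈ S.carrier ∩ Icc v t, ‖A u‖ ≤ M) (hshort : M * (t - v) < 1)
    {c : ℝ} (hc : c ∈ S.carrier ∩ Icc v t) (hzc : z c = 0) :
    ∀ u ∈ S.carrier ∩ Icc v t, z u = 0 := by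
  have hK := h.convex v hv t ht
  obtain ⟨m, hm, hmax⟩ := (S.isCompact_inter_Icc v t).exists_isMaxOn ⟨c, hc⟩
    (hz.continuousOn.norm.mono hK)
  have hcs := hK hc
  have hms := hK hm
  have h1 : ‖z m‖ ≤ M * ‖z m‖ * |m - c| := by
    have h2 := hz.sub_eq h hA ha hcs hms (hav.trans hc.2.1) (hav.trans hm.2.1)
    rw [hzc, sub_zero] at h2
    rw [h2]
    refine h.norm_deltaIntegral_le hcs hms fun u hu hu1 hu2 => ?_
    have huK : u ∈ S.carrier ∩ Icc v t := ⟨S.sub_subset hu, (le_min hc.2.1 hm.2.1).trans hu1,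
      hu2.trans (max_le hc.2.2 hm.2.2)⟩
    rw [← h2]
    refine (Matrix.linfty_opNorm_mulVec _ _).trans ?_
    exact mul_le_mul (hM u huK) (hmax huK) (norm_nonneg _) hM0
  have h2 : |m - c| ≤ t - v := by
    rw [abs_le]
    constructor <;> linarith [hm.2.1, hm.2.2, hc.2.1, hc.2.2]
  have h3 : ‖z m‖ ≤ M * (t - v) * ‖z m‖ := by
    refine h1.trans ?_
    rw [mul_right_comm]
    gcongr
  have h4 : ‖z m‖ = 0 := by
    nlinarith [norm_nonneg (z m)]
  intro u hu
  have h5 : ‖z u‖ ≤ ‖z m‖ := hmax hu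
  rw [h4] at h5
  exact norm_le_zero_iff.1 h5

/-- For a regressive coefficient, a solution vanishes at one point iff it vanishes at another. -/
theorem eq_zero_iff (h : S.ShiftPeriodic T) (hA : S.RdContinuous A) (hreg : S.Regressive A)
    (ha : a ∈ S.sub) (hz : S.IsIntegralSolution A a z) {b : ℝ} (hb : b ∈ S.sub) (hab : a ≤ b) :
    z a = 0 ↔ z b = 0 := by
  obtain ⟨M, hM0, hM⟩ := hA.exists_bound h ha hb
  -- The `+ 1` covers M = 0 and makes M times any shorter length less than 1.
  have hr : (0 : ℝ) < 1 / (M + 1) := by positivity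
  have hshort : ∀ x < 1 / (M + 1), 0 < x → M * x < 1 := fun x hx hx0 => by
    rw [lt_div_iff₀ (by positivity)] at hx
    nlinarith
  have hstep : ∀ v ∈ S.sub, ∀ t ∈ S.sub, a ≤ v → t ≤ b → v < t → t - v < 1 / (M + 1) →
      (z v = 0 ↔ z t = 0) := by
    intro v hv t ht hav htb hvt hlt
    have key := fun {c} => hz.eq_zero_of_short h hA ha hv ht hav hM0
      (fun u hu => hM u ⟨hu.1, hav.trans hu.2.1, hu.2.2.trans htb⟩)
      (hshort _ hlt (sub_pos.2 hvt)) (c := c)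
    have hvK : v ∈ S.carrier ∩ Icc v t := ⟨S.sub_subset hv, le_rfl, hvt.le⟩
    have htK : t ∈ S.carrier ∩ Icc v t := ⟨S.sub_subset ht, hvt.le, le_rfl⟩
    exact ⟨fun h0 => key hvK h0 t htK, fun h0 => key htK h0 v hvK⟩
  refine h.timeScale_induction (P := fun t => z a = 0 ↔ z t = 0) ha hb hab Iff.rfl ?_ ?_ ?_
  · intro t ht hat htb hs hP
    have h1 := hz.sub_eq h hA ha ht (h.sigma_mem ht) hat (hat.trans hs.le)
    rw [h.deltaIntegral_sigma _ ht] at h1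
    have h2 : z (S.sigma t) = (1 + (S.sigma t - t) • A t).mulVec (z t) := by
      rw [Matrix.add_mulVec, Matrix.one_mulVec, Matrix.smul_mulVec, ← h1]
      abel
    rw [hP, h2]
    -- Across a gap the solution is multiplied by I + μ(t)A(t); regressivity is what allows going
    -- back.
    have hinj := Matrix.mulVec_injective_iff_isUnit.2 (hreg t ht)
    exact (hinj.eq_iff' (Matrix.mulVec_zero _)).symm
  · intro t ht hat htb _ hP
    refine ⟨min b (t + 1 / (M + 1)), lt_min htb (by linarith), fun v hv htv hvc => ?_⟩
    have h1 := hvc.trans_le (min_le_left _ _)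
    have h2 := hvc.trans_le (min_le_right _ _)
    exact hP.trans (hstep t ht v hv hat h1.le htv (by linarith))
  · intro t ht hat htb hdense hP
    obtain ⟨v, hv, hcv, hvt⟩ := hdense (max a (t - 1 / (M + 1))) (max_lt hat (by linarith))
    have h1 := (le_max_left _ _).trans_lt hcv
    have h2 := (le_max_right _ _).trans_lt hcv
    exact (hP v hv h1.le hvt).trans (hstep v hv t ht h1.le htb hvt (by linarith))

end IsIntegralSolution

/-- Evaluation of matrices on a vector. -/
noncomputable def mulVecCLM (w : Fin n → ℝ) : Matrix (Fin n) (Fin n) ℝ →L[ℝ] (Fin n → ℝ) :=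
  LinearMap.toContinuousLinearMap ((Matrix.mulVecBilin ℝ ℝ).flip w)

theorem HasDeltaDeriv.mulVec_const {F : ℝ → Matrix (Fin n) (Fin n) ℝ}
    {F' : Matrix (Fin n) (Fin n) ℝ} {t : ℝ} (hF : S.HasDeltaDeriv F F' t) (w : Fin n → ℝ) :
    S.HasDeltaDeriv (fun u => (F u).mulVec w) (F'.mulVec w) t :=
  hF.clm_apply (mulVecCLM w)

theorem RdContinuous.deltaIntegral_mulVec_const (h : S.ShiftPeriodic T)
    {F : ℝ → Matrix (Fin n) (Fin n) ℝ} (hF : S.RdContinuous F) (w : Fin n → ℝ) {a b : ℝ}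
    (ha : a ∈ S.sub) (hb : b ∈ S.sub) :
    S.deltaIntegral (fun t => (F t).mulVec w) a b = (S.deltaIntegral F a b).mulVec w :=
  hF.deltaIntegral_clm h (mulVecCLM w) ha hb

/-- The integrated form is used because the constant extension to the left of s can spoil the delta
derivative at s. -/
theorem isIntegralSolution_fundamental (h : S.ShiftPeriodic T) (hA : S.RdContinuous A) {s : ℝ}
    (hs : s ∈ S.sub) (w : Fin n → ℝ) :
    S.IsIntegralSolution A s fun t => (S.fundamental A s t).mulVec w := by
  have hc := continuousOn_fundamental h hA hs
  refine ⟨(mulVecCLM w).continuous.comp_continuousOn hc, fun t ht hst => ?_⟩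
  have h1 := (hA.matrix_mul (rdContinuous_of_continuousOn hc)).deltaIntegral_mulVec_const h w hs ht
  simp only [← Matrix.mulVec_mulVec] at h1
  rw [h1, fundamental_self h hA hs, fundamental_eq h hA hs ht hst, Matrix.add_mulVec,
    add_sub_cancel_left]

/-- Applied to a basis vector, both sides solve the equation from r onwards with the same value at
r. -/
theorem fundamental_mul (h : S.ShiftPeriodic T) (hA : S.RdContinuous A) (hreg : S.Regressive A)
    {s r t : ℝ} (hs : s ∈ S.sub) (hr : r ∈ S.sub) (ht : t ∈ S.sub) (hsr : s ≤ r) (hrt : r ≤ t) :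
    S.fundamental A r t * S.fundamental A s r = S.fundamental A s t := by
  refine Matrix.ext_of_mulVec_single fun i => ?_
  set w : Fin n → ℝ := Pi.single i 1
  have h1 := ((isIntegralSolution_fundamental h hA hs w).mono h hA hs hr hsr).sub h hA hr
    (isIntegralSolution_fundamental h hA hr ((S.fundamental A s r).mulVec w))
  have h2 := (h1.eq_zero_iff h hA hreg hr ht hrt).1
    (by rw [fundamental_self h hA hr, Matrix.one_mulVec, sub_self])
  rw [← Matrix.mulVec_mulVec]
  exact (sub_eq_zero.1 h2).symm

/-- A kernel vector w yields a solution vanishing at t, hence at s, where its value is w. -/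
theorem isUnit_fundamental (h : S.ShiftPeriodic T) (hA : S.RdContinuous A) (hreg : S.Regressive A)
    {s t : ℝ} (hs : s ∈ S.sub) (ht : t ∈ S.sub) (hst : s ≤ t) : IsUnit (S.fundamental A s t) := by
  rw [← Matrix.mulVec_injective_iff_isUnit]
  refine (injective_iff_map_eq_zero (S.fundamental A s t).mulVecLin).2 fun w hw => ?_
  have := ((isIntegralSolution_fundamental h hA hs w).eq_zero_iff h hA hreg hs ht hst).2 hw
  rwa [fundamental_self h hA hs, Matrix.one_mulVec] at this

/-! ### The transition matrix -/

/-- A base point a to the left of both arguments merges the two branches of the definition into one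
formula, which can be differentiated across t₀. -/
theorem transition_eq (h : S.ShiftPeriodic T) (hA : S.RdContinuous A) (hreg : S.Regressive A)
    {a t : ℝ} (ha : a ∈ S.sub) (ht : t ∈ S.sub) (ha0 : a ≤ S.t₀) (hat : a ≤ t) :
    S.transition A t S.t₀ = S.fundamental A a t * (S.fundamental A a S.t₀)⁻¹ := by
  have hu := (isUnit_fundamental h hA hreg ha S.t₀_mem ha0)
  have hdet := (Matrix.isUnit_iff_isUnit_det _).1 hu
  rw [transition]
  split_ifs with h0
  · rw [← fundamental_mul h hA hreg ha S.t₀_mem ht ha0 h0,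
      Matrix.mul_nonsing_inv_cancel_right _ _ hdet, fundamental, max_eq_right h0]
  · push Not at h0
    have hu2 := (Matrix.isUnit_iff_isUnit_det _).1 (isUnit_fundamental h hA hreg ha ht hat)
    rw [← fundamental_mul h hA hreg ha ht S.t₀_mem hat h0.le, Matrix.mul_inv_rev,
      Matrix.mul_nonsing_inv_cancel_left _ _ hu2, fundamental, max_eq_right h0.le]

theorem exists_le_t₀ (h : S.ShiftPeriodic T) {t : ℝ} (ht : t ∈ S.sub) :
    ∃ a ∈ S.sub, a ≤ S.t₀ ∧ a < t := by
  rcases le_total t S.t₀ with h0 | h0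
  · exact ⟨_, h.δm_mem ht, (h.δm_lt_self ht).le.trans h0, h.δm_lt_self ht⟩
  · exact ⟨_, h.δm_mem S.t₀_mem, (h.δm_lt_self S.t₀_mem).le, (h.δm_lt_self S.t₀_mem).trans_le h0⟩

theorem isUnit_transition (h : S.ShiftPeriodic T) (hA : S.RdContinuous A) (hreg : S.Regressive A)
    {t : ℝ} (ht : t ∈ S.sub) : IsUnit (S.transition A t S.t₀) := by
  obtain ⟨a, ha, ha0, hat⟩ := exists_le_t₀ h ht
  rw [transition_eq h hA hreg ha ht ha0 hat.le]
  exact (isUnit_fundamental h hA hreg ha ht hat.le).mul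
    (Matrix.isUnit_nonsing_inv_iff.2 (isUnit_fundamental h hA hreg ha S.t₀_mem ha0))

theorem transition_self (h : S.ShiftPeriodic T) (hA : S.RdContinuous A) (hreg : S.Regressive A) :
    S.transition A S.t₀ S.t₀ = 1 := by
  rw [transition_eq h hA hreg S.t₀_mem S.t₀_mem le_rfl le_rfl, fundamental_self h hA S.t₀_mem,
    inv_one, one_mul]

theorem hasDeltaDeriv_transition (h : S.ShiftPeriodic T) (hA : S.RdContinuous A)
    (hreg : S.Regressive A) {t : ℝ} (ht : t ∈ S.sub) :
    S.HasDeltaDeriv (fun u => S.transition A u S.t₀) (A t * S.transition A t S.t₀) t := by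
  -- Strictness of a < t makes the formula valid on a full neighbourhood of t.
  obtain ⟨a, ha, ha0, hat⟩ := exists_le_t₀ h ht
  have hrd := hA.matrix_mul (rdContinuous_of_continuousOn (continuousOn_fundamental h hA ha))
  have h1 := hrd.hasDeltaDeriv_deltaIntegral h ha ht
  set C := (S.fundamental A a S.t₀)⁻¹
  have h2 := h1.clm_apply (LinearMap.toContinuousLinearMap (LinearMap.mulRight ℝ C))
  simp only [LinearMap.coe_toContinuousLinearMap', LinearMap.mulRight_apply] at h2
  rw [transition_eq h hA hreg ha ht ha0 hat.le, ← mul_assoc]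
  have heq : ∀ u ∈ S.sub, a ≤ u → S.transition A u S.t₀ =
      C + S.deltaIntegral (fun τ => A τ * S.fundamental A a τ) a u * C := fun u hu hau => by
    rw [transition_eq h hA hreg ha hu ha0 hau, fundamental_eq h hA ha hu hau, add_mul, one_mul]
  intro ε hε
  filter_upwards [h2 ε hε, self_mem_nhdsWithin, nhdsWithin_le_nhds (Ioi_mem_nhds hat)]
    with u hu hus hau
  rw [heq u hus (le_of_lt hau), heq _ (h.sigma_mem ht) (hat.le.trans (h.le_sigma ht)),
    add_sub_add_left_eq_sub]
  exact hu

theorem continuousOn_transition (h : S.ShiftPeriodic T) (hA : S.RdContinuous A)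
    (hreg : S.Regressive A) : ContinuousOn (fun u => S.transition A u S.t₀) S.sub :=
  fun _ ht => (hasDeltaDeriv_transition h hA hreg ht).continuousWithinAt ht

theorem continuousOn_transition_inv (h : S.ShiftPeriodic T) (hA : S.RdContinuous A)
    (hreg : S.Regressive A) : ContinuousOn (fun u => (S.transition A u S.t₀)⁻¹) S.sub := by
  intro t ht
  have h1 : ContinuousAt (fun M : Matrix (Fin n) (Fin n) ℝ => M⁻¹) (S.transition A t S.t₀) := by
    refine continuousAt_matrix_inv _ ?_
    rw [Ring.inverse_eq_inv']
    exact continuousAt_inv₀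
      ((Matrix.isUnit_iff_isUnit_det _).1 (isUnit_transition h hA hreg ht)).ne_zero
  exact ContinuousAt.comp_continuousWithinAt (f := fun u => S.transition A u S.t₀) h1
    (continuousOn_transition h hA hreg t ht)

theorem eq_transition_mulVec (h : S.ShiftPeriodic T) (hA : S.RdContinuous A)
    (hreg : S.Regressive A) {z : ℝ → Fin n → ℝ}
    (hz : ∀ t ∈ S.sub, S.HasDeltaDeriv z ((A t).mulVec (z t)) t) {t : ℝ} (ht : t ∈ S.sub) :
    z t = (S.transition A t S.t₀).mulVec (z S.t₀) := by
  set y : ℝ → Fin n → ℝ := fun t => z t - (S.transition A t S.t₀).mulVec (z S.t₀) with hy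
  have hyd : ∀ t ∈ S.sub, S.HasDeltaDeriv y ((A t).mulVec (y t)) t := fun t ht => by
    have h1 := (hz t ht).sub ((hasDeltaDeriv_transition h hA hreg ht).mulVec_const (z S.t₀))
    simpa [hy, Matrix.mulVec_sub] using h1
  have hyc : ContinuousOn y S.sub := fun t ht => (hyd t ht).continuousWithinAt ht
  have hsol : ∀ a ∈ S.sub, S.IsIntegralSolution A a y := fun a ha =>
    ⟨hyc, fun t ht _ => h.sub_eq_deltaIntegral (hA.mulVec (rdContinuous_of_continuousOn hyc))
      hyd ha ht⟩
  have hy0 : y S.t₀ = 0 := by simp [hy, transition_self h hA hreg]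
  refine sub_eq_zero.1 (show y t = 0 from ?_)
  rcases le_total t S.t₀ with h0 | h0
  · exact ((hsol t ht).eq_zero_iff h hA hreg ht S.t₀_mem h0).2 hy0
  · exact ((hsol _ S.t₀_mem).eq_zero_iff h hA hreg S.t₀_mem ht h0).1 hy0

/-- Floquet's relation `Φ(δ₊ᵀ(t), t₀) = Φ(t, t₀) Φ(T, t₀)`. -/
theorem transition_δp (h : S.ShiftPeriodic T) (hA : S.RdContinuous A) (hreg : S.Regressive A)
    (hper : S.DeltaPeriodicInShifts T A) {t : ℝ} (ht : t ∈ S.sub) :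
    S.transition A (S.δp T t) S.t₀ = S.transition A t S.t₀ * S.transition A T S.t₀ := by
  refine Matrix.ext_of_mulVec_single fun i => ?_
  set w : Fin n → ℝ := Pi.single i 1
  -- By the chain rule and the periodicity of A, t ↦ Φ(δ₊(t))w solves the same equation; its value
  -- at t₀ is Φ(T)w.
  have h1 := eq_transition_mulVec h hA hreg
    (z := fun t => (S.transition A (S.δp T t) S.t₀).mulVec w) (fun t ht => by
      have h2 := ((hasDeltaDeriv_transition h hA hreg (h.δp_mem ht)).mulVec_const
        w).comp_δp h ht (hasDeltaDeriv_deltaDeriv (hper.1.1 t ht))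
      have h3 := (hper.2 t ht).1
      rwa [← Matrix.mulVec_mulVec, ← Matrix.smul_mulVec, h3] at h2) ht
  rw [h1, h.δp_t₀, Matrix.mulVec_mulVec]

/-- A kernel vector w satisfies Φ(T)w = w, so Φ(t)w is periodic by Floquet's relation and vanishes
by non-criticality; at t₀ it equals w. -/
theorem isUnit_inv_transition_sub_one (h : S.ShiftPeriodic T) (hA : S.RdContinuous A)
    (hreg : S.Regressive A) (hper : S.DeltaPeriodicInShifts T A) (hcrit : S.NonCritical A T) :
    IsUnit ((S.transition A T S.t₀)⁻¹ - 1) := by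
  have hdet := (Matrix.isUnit_iff_isUnit_det _).1 (isUnit_transition h hA hreg h.T_mem)
  rw [← Matrix.mulVec_injective_iff_isUnit]
  refine (injective_iff_map_eq_zero (Matrix.mulVecLin _)).2 fun w hw => ?_
  rw [Matrix.mulVecLin_apply, Matrix.sub_mulVec, Matrix.one_mulVec, sub_eq_zero] at hw
  have hw' : (S.transition A T S.t₀).mulVec w = w := by
    nth_rw 1 [← hw]
    rw [Matrix.mulVec_mulVec, Matrix.mul_nonsing_inv _ hdet, Matrix.one_mulVec]
  have hp : ∀ t ∈ S.sub, (S.transition A (S.δp T t) S.t₀).mulVec w =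
      (S.transition A t S.t₀).mulVec w := fun t ht => by
    rw [transition_δp h hA hreg hper ht, ← Matrix.mulVec_mulVec, hw']
  have h1 := hcrit (fun t => (S.transition A t S.t₀).mulVec w) (fun t ht => by
    simpa [← Matrix.mulVec_mulVec] using
      (hasDeltaDeriv_transition h hA hreg ht).mulVec_const w)
    (fun t ht => ⟨hp t ht, by
      have := hp _ (h.δm_mem ht)
      rw [h.δp_δm ht] at this
      exact this.symm⟩) S.t₀ S.t₀_mem
  simpa [transition_self h hA hreg] using h1

/-! ### Superposition of rd-continuous functions -/

/-- Rd-continuity of Q and G is assumed only along continuous arguments, while elements of P_T may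
jump. A uniform Lipschitz bound lets the argument be frozen at its limit L. -/
theorem tendsto_comp_of_lipschitz {X E F : Type*} [NormedAddCommGroup E] [NormedAddCommGroup F]
    {f : X → E → F} {y : X → E} {L : E} {M : F} {C : ℝ} {l : Filter X} (hy : Tendsto y l (𝓝 L))
    (hf : Tendsto (fun u => f u L) l (𝓝 M))
    (hC : ∀ᶠ u in l, ∀ a b, ‖f u a - f u b‖ ≤ C * ‖a - b‖) :
    Tendsto (fun u => f u (y u)) l (𝓝 M) := by
  have h1 : Tendsto (fun u => f u (y u) - f u L) l (𝓝 0) := by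
    refine squeeze_zero_norm' (hC.mono fun u hu => hu _ _) ?_
    have := (tendsto_iff_norm_sub_tendsto_zero.1 hy).const_mul C
    rwa [mul_zero] at this
  simpa using h1.add hf

theorem RdAt.comp_lipschitz {E F : Type*} [NormedAddCommGroup E] [NormedAddCommGroup F]
    {f : ℝ → E → F} {y : ℝ → E} {t c C : ℝ} (hct : c < t) (hy : S.RdAt y t)
    (hf : ∀ a, S.RdAt (fun u => f u a) t)
    (hC : ∀ u ∈ S.sub, c ≤ u → ∀ a b, ‖f u a - f u b‖ ≤ C * ‖a - b‖) :
    S.RdAt (fun u => f u (y u)) t := by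
  have hev : ∀ᶠ u in 𝓝[S.sub] t, ∀ a b, ‖f u a - f u b‖ ≤ C * ‖a - b‖ := by
    filter_upwards [self_mem_nhdsWithin, nhdsWithin_le_nhds (Ioi_mem_nhds hct)] with u hu hcu
      using hC u hu (le_of_lt hcu)
  refine ⟨fun e => tendsto_comp_of_lipschitz (hy.1 e) ((hf (y t)).1 e) hev, ?_⟩
  obtain ⟨L, hL⟩ := hy.2
  obtain ⟨M, hM⟩ := (hf L).2
  exact ⟨M, tendsto_comp_of_lipschitz hL hM (hev.filter_mono (nhdsWithin_mono _ inter_subset_left))⟩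

/-! ### The assumptions on the neutral equation -/

/-- The assumptions on the data of the neutral equation
`x^Δ(t) = A(t) x(t) + Q^Δ(t, x(δ₋(s, t))) + G(t, x(t), x(δ₋(s, t)))`. -/
structure NeutralData (S : ShiftTimeScale) (T s : ℝ) (A : ℝ → Matrix (Fin n) (Fin n) ℝ)
    (Q : ℝ → (Fin n → ℝ) → Fin n → ℝ) (G : ℝ → (Fin n → ℝ) → (Fin n → ℝ) → Fin n → ℝ)
    (E₁ E₂ E₃ : ℝ) : Prop where
  shift : S.ShiftPeriodic T
  delay : ∀ t ∈ S.sub, (s, t) ∈ S.domm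
  delay_cont : ContinuousOn (S.δm s) S.sub
  rdA : S.RdContinuous A
  reg : S.Regressive A
  bdd : BddAbove (S.rowNorms A)
  rdQ : S.RdContinuous₁ Q
  rdG : S.RdContinuous₂ G
  crit : S.NonCritical A T
  perA : S.DeltaPeriodicInShifts T A
  perQ : ∀ x ∈ S.periodicSpace n T, ∀ t ∈ S.sub,
    Q (S.δp T t) (x (S.δm s (S.δp T t))) = Q t (x (S.δm s t))
  perG : ∀ x ∈ S.periodicSpace n T, ∀ t ∈ S.sub,
    S.deltaDeriv (S.δp T) t • G (S.δp T t) (x (S.δp T t)) (x (S.δm s (S.δp T t))) =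
      G t (x t) (x (S.δm s t))
  lipQ : ∀ t ∈ S.carrier, S.t₀ ≤ t → ∀ x y, ‖Q t x - Q t y‖ ≤ E₁ * ‖x - y‖
  lipG : ∀ t ∈ S.carrier, S.t₀ ≤ t → ∀ x y z w,
    ‖G t x y - G t z w‖ ≤ E₂ * ‖x - z‖ + E₃ * ‖y - w‖
  nonneg₁ : 0 ≤ E₁
  nonneg₂ : 0 ≤ E₂
  nonneg₃ : 0 ≤ E₃

/-- The inhomogeneity `A(u) Q(u, φ(δ₋(s, u))) + G(u, φ(u), φ(δ₋(s, u)))`. -/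
def forcing (S : ShiftTimeScale) (A : ℝ → Matrix (Fin n) (Fin n) ℝ)
    (Q : ℝ → (Fin n → ℝ) → Fin n → ℝ) (G : ℝ → (Fin n → ℝ) → (Fin n → ℝ) → Fin n → ℝ) (s : ℝ)
    (φ : ℝ → Fin n → ℝ) (u : ℝ) : Fin n → ℝ :=
  (A u).mulVec (Q u (φ (S.δm s u))) + G u (φ u) (φ (S.δm s u))

/-- The integrand `Φ_A⁻¹(σ(u), t₀) [A(u) Q(u, φ(δ₋(s, u))) + G(u, φ(u), φ(δ₋(s, u)))]`. -/
noncomputable def integrand (S : ShiftTimeScale) (A : ℝ → Matrix (Fin n) (Fin n) ℝ)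
    (Q : ℝ → (Fin n → ℝ) → Fin n → ℝ) (G : ℝ → (Fin n → ℝ) → (Fin n → ℝ) → Fin n → ℝ) (s : ℝ)
    (φ : ℝ → Fin n → ℝ) (u : ℝ) : Fin n → ℝ :=
  (S.transition A (S.sigma u) S.t₀)⁻¹.mulVec (S.forcing A Q G s φ u)

/-! ### Delta calculus for matrix-vector products. -/

theorem HasDeltaDeriv.mulVec {F : ℝ → Matrix (Fin n) (Fin n) ℝ} {F' : Matrix (Fin n) (Fin n) ℝ}
    {f : ℝ → Fin n → ℝ} {f' : Fin n → ℝ} {t : ℝ} (ht : t ∈ S.sub) (hF : S.HasDeltaDeriv F F' t)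
    (hf : S.HasDeltaDeriv f f' t) : S.HasDeltaDeriv (fun u => (F u).mulVec (f u))
      (F'.mulVec (f t) + (F (S.sigma t)).mulVec f') t :=
  hF.bilin ht hf (LinearMap.mkContinuous₂ (Matrix.mulVecBilin ℝ ℝ) 1 fun M v => by
    rw [one_mul]
    exact Matrix.linfty_opNorm_mulVec M v)

theorem HasDeltaDeriv.const_mulVec {f : ℝ → Fin n → ℝ} {f' : Fin n → ℝ} {t : ℝ}
    (hf : S.HasDeltaDeriv f f' t) (M : Matrix (Fin n) (Fin n) ℝ) :
    S.HasDeltaDeriv (fun u => M.mulVec (f u)) (M.mulVec f') t :=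
  hf.clm_apply (LinearMap.toContinuousLinearMap M.mulVecLin)

theorem RdContinuous.const_mulVec {f : ℝ → Fin n → ℝ} (hf : S.RdContinuous f)
    (M : Matrix (Fin n) (Fin n) ℝ) : S.RdContinuous fun u => M.mulVec (f u) :=
  (rdContinuous_of_continuousOn continuousOn_const).mulVec hf

theorem RdContinuous.deltaIntegral_const_mulVec (h : S.ShiftPeriodic T) {f : ℝ → Fin n → ℝ}
    (hf : S.RdContinuous f) (M : Matrix (Fin n) (Fin n) ℝ) {a b : ℝ} (ha : a ∈ S.sub)
    (hb : b ∈ S.sub) :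
    S.deltaIntegral (fun u => M.mulVec (f u)) a b = M.mulVec (S.deltaIntegral f a b) :=
  hf.deltaIntegral_clm h (LinearMap.toContinuousLinearMap M.mulVecLin) ha hb

/-! ### The operator H maps P_T into itself. -/

namespace NeutralData

variable {s : ℝ} {Q : ℝ → (Fin n → ℝ) → Fin n → ℝ}
  {G : ℝ → (Fin n → ℝ) → (Fin n → ℝ) → Fin n → ℝ} {E₁ E₂ E₃ : ℝ} {φ ψ : ℝ → Fin n → ℝ}

theorem delay_mem (H : NeutralData S T s A Q G E₁ E₂ E₃) {t : ℝ} (ht : t ∈ S.sub) :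
    S.δm s t ∈ S.sub := (H.delay t ht).2.2.2

theorem hasDeltaDeriv_δp (H : NeutralData S T s A Q G E₁ E₂ E₃) {t : ℝ} (ht : t ∈ S.sub) :
    S.HasDeltaDeriv (S.δp T) (S.deltaDeriv (S.δp T) t) t :=
  hasDeltaDeriv_deltaDeriv (H.perA.1.1 t ht)

theorem rdContinuous_comp_delay (H : NeutralData S T s A Q G E₁ E₂ E₃) (hφ : S.RdContinuous φ) :
    S.RdContinuous fun u => φ (S.δm s u) := by
  intro t ht
  have h := H.shift
  have hp := H.delay_mem ht
  have htend : Tendsto (S.δm s) (𝓝[S.sub] t) (𝓝[S.sub] (S.δm s t)) :=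
    tendsto_nhdsWithin_iff.2 ⟨H.delay_cont t ht,
      eventually_mem_nhdsWithin.mono fun _ hu => H.delay_mem hu⟩
  refine (hφ.rdAt hp).comp_tendsto htend
    (fun u hu hut => S.δm_lt s u t (H.delay u hu) (H.delay t ht) hut) fun e => ?_
  -- A right-dense t goes to a right-dense point: otherwise points v > t close to t would have
  -- delays strictly between δ₋(s, t) and its successor.
  by_contra hne
  have hlt := lt_of_le_of_ne (h.le_sigma hp) (Ne.symm hne)
  obtain ⟨δ, hδ, hball⟩ := Metric.eventually_nhds_iff.1 (eventually_nhdsWithin_iff.1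
    ((H.delay_cont t ht).tendsto.eventually_lt_const hlt))
  obtain ⟨v, hv, htv, hvc⟩ := h.exists_lt_of_sigma_lt ht
    (c := min (t + δ) (S.δp T t)) (by rw [e]; exact lt_min (by linarith) (h.lt_δp ht))
  have hvs := h.mem_of_mem_Icc ht (h.δp_mem ht) hv htv.le (hvc.le.trans (min_le_right _ _))
  have hvδ := hvc.trans_le (min_le_left _ _)
  have h1 := hball (y := v) (by rw [Real.dist_eq, abs_of_pos (by linarith)]; linarith) hvs
  exact absurd (h.sigma_le hp (S.sub_subset (H.delay_mem hvs))
    (S.δm_lt s t v (H.delay t ht) (H.delay v hvs) htv)) (not_le.2 h1)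

/-- The Lipschitz bound is available only from t₀ on, so the superposition argument works right of
t₀; periodicity carries the property to the remaining points. -/
theorem rdContinuous_opB (H : NeutralData S T s A Q G E₁ E₂ E₃) (hφ : φ ∈ S.periodicSpace n T) :
    S.RdContinuous (S.opB Q s φ) := by
  refine H.shift.shift_induction_down (P := S.RdAt (S.opB Q s φ)) S.t₀_mem
    (fun t ht h0 => ?_) fun t ht hP => ?_
  · exact RdAt.comp_lipschitz (f := Q) (y := fun u => φ (S.δm s u)) h0
      ((H.rdContinuous_comp_delay hφ.1).rdAt ht)
      (fun a => H.rdQ (fun _ => a) continuousOn_const t ht)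
      fun u hu h0 => H.lipQ u (S.sub_subset hu) h0
  · exact (hP.comp_δp H.shift ht (H.hasDeltaDeriv_δp ht)).congr ht fun u hu => H.perQ φ hφ u hu

theorem rdContinuous_G (H : NeutralData S T s A Q G E₁ E₂ E₃) (hφ : φ ∈ S.periodicSpace n T) :
    S.RdContinuous fun u => G u (φ u) (φ (S.δm s u)) := by
  refine H.shift.shift_induction_down (P := S.RdAt fun u => G u (φ u) (φ (S.δm s u))) S.t₀_mem
    (fun t ht h0 => ?_) fun t ht hP => ?_
  · refine RdAt.comp_lipschitz (f := fun u (p : (Fin n → ℝ) × (Fin n → ℝ)) => G u p.1 p.2)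
      (y := fun u => (φ u, φ (S.δm s u))) (C := E₂ + E₃) h0
      ((hφ.1.rdAt ht).comp₂ ((H.rdContinuous_comp_delay hφ.1).rdAt ht) continuous_id)
      (fun a => H.rdG (fun _ => a.1) (fun _ => a.2) continuousOn_const continuousOn_const t ht)
      fun u hu h0 a b => ?_
    refine (H.lipG u (S.sub_subset hu) h0 _ _ _ _).trans ?_
    rw [add_mul]
    exact add_le_add (mul_le_mul_of_nonneg_left (norm_fst_le (a - b)) H.nonneg₂)
      (mul_le_mul_of_nonneg_left (norm_snd_le (a - b)) H.nonneg₃)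
  · exact (RdAt.comp₂ (H.perA.1.2.1 t ht) (hP.comp_δp H.shift ht (H.hasDeltaDeriv_δp ht))
      continuous_smul).congr ht fun u hu => H.perG φ hφ u hu

theorem rdContinuous_forcing (H : NeutralData S T s A Q G E₁ E₂ E₃)
    (hφ : φ ∈ S.periodicSpace n T) : S.RdContinuous (S.forcing A Q G s φ) :=
  (H.rdA.mulVec (H.rdContinuous_opB hφ)).comp₂ (H.rdContinuous_G hφ) continuous_add

theorem forcing_δp (H : NeutralData S T s A Q G E₁ E₂ E₃) (hφ : φ ∈ S.periodicSpace n T) {t : ℝ}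
    (ht : t ∈ S.sub) : S.deltaDeriv (S.δp T) t • S.forcing A Q G s φ (S.δp T t) =
      S.forcing A Q G s φ t := by
  simp only [forcing]
  rw [smul_add, H.perG φ hφ t ht, ← Matrix.smul_mulVec, (H.perA.2 t ht).1, H.perQ φ hφ t ht]

theorem rdContinuous_integrand (H : NeutralData S T s A Q G E₁ E₂ E₃)
    (hφ : φ ∈ S.periodicSpace n T) : S.RdContinuous (S.integrand A Q G s φ) :=
  (rdContinuous_comp_sigma H.shift
    (continuousOn_transition_inv H.shift H.rdA H.reg)).mulVec (H.rdContinuous_forcing hφ)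

theorem integrand_δp (H : NeutralData S T s A Q G E₁ E₂ E₃) (hφ : φ ∈ S.periodicSpace n T) {t : ℝ}
    (ht : t ∈ S.sub) : S.deltaDeriv (S.δp T) t • S.integrand A Q G s φ (S.δp T t) =
      (S.transition A T S.t₀)⁻¹.mulVec (S.integrand A Q G s φ t) := by
  simp only [integrand]
  rw [← Matrix.mulVec_smul, H.forcing_δp hφ ht, H.shift.sigma_δp ht,
    transition_δp H.shift H.rdA H.reg H.perA (H.shift.sigma_mem ht), Matrix.mul_inv_rev,
    Matrix.mulVec_mulVec]

/-- The shifted integral of the integrand. -/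
theorem deltaIntegral_integrand_δp (H : NeutralData S T s A Q G E₁ E₂ E₃)
    (hφ : φ ∈ S.periodicSpace n T) {a b : ℝ} (ha : a ∈ S.sub) (hb : b ∈ S.sub) :
    S.deltaIntegral (S.integrand A Q G s φ) (S.δp T a) (S.δp T b) =
      (S.transition A T S.t₀)⁻¹.mulVec (S.deltaIntegral (S.integrand A Q G s φ) a b) := by
  have hrd := H.rdContinuous_integrand hφ
  rw [← hrd.deltaIntegral_const_mulVec H.shift _ ha hb]
  exact H.shift.deltaIntegral_comp_δp H.perA.1.1 hrd (hrd.const_mulVec _)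
    (fun t ht => H.integrand_δp hφ ht) ha hb

theorem opC_eq (H : NeutralData S T s A Q G E₁ E₂ E₃) (φ : ℝ → Fin n → ℝ) (t : ℝ) :
    S.opC A Q G s T φ t = (S.transition A t S.t₀ * ((S.transition A T S.t₀)⁻¹ - 1)⁻¹).mulVec
      (S.deltaIntegral (S.integrand A Q G s φ) t (S.δp T t)) := by
  simp only [opC]
  rw [H.shift.δp_t₀]
  rfl

theorem isUnit_det (H : NeutralData S T s A Q G E₁ E₂ E₃) {t : ℝ} (ht : t ∈ S.sub) :
    IsUnit (S.transition A t S.t₀).det :=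
  (Matrix.isUnit_iff_isUnit_det _).1 (isUnit_transition H.shift H.rdA H.reg ht)

theorem isUnit_det_sub_one (H : NeutralData S T s A Q G E₁ E₂ E₃) :
    IsUnit ((S.transition A T S.t₀)⁻¹ - 1).det :=
  (Matrix.isUnit_iff_isUnit_det _).1
    (isUnit_inv_transition_sub_one H.shift H.rdA H.reg H.perA H.crit)

/-- With g the integrand, the derivative of ∫ g from t to δ₊(t) is δ₊^Δ(t) g(δ₊(t)) - g(t) = (Φ(T)⁻¹
- I) g(t). In the product rule this factor cancels against its inverse, and Φ(σ(t)) cancels the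
inverse inside g. -/
theorem hasDeltaDeriv_opC (H : NeutralData S T s A Q G E₁ E₂ E₃) (hφ : φ ∈ S.periodicSpace n T)
    {t : ℝ} (ht : t ∈ S.sub) : S.HasDeltaDeriv (S.opC A Q G s T φ)
      ((A t).mulVec (S.opC A Q G s T φ t) + S.forcing A Q G s φ t) t := by
  have h := H.shift
  have hrd := H.rdContinuous_integrand hφ
  set N := (S.transition A T S.t₀)⁻¹ - 1 with hN
  have h1 : S.HasDeltaDeriv (fun u => S.deltaIntegral (S.integrand A Q G s φ) u (S.δp T u))
      (N.mulVec (S.integrand A Q G s φ t)) t := by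
    have h2 := ((hrd.hasDeltaDeriv_deltaIntegral h S.t₀_mem (h.δp_mem ht)).comp_δp h ht
      (H.hasDeltaDeriv_δp ht)).sub (hrd.hasDeltaDeriv_deltaIntegral h S.t₀_mem ht)
    rw [H.integrand_δp hφ ht] at h2
    rw [hN, Matrix.sub_mulVec, Matrix.one_mulVec]
    refine h2.congr h ht fun u hu => ?_
    rw [← hrd.deltaIntegral_add h S.t₀_mem hu (h.δp_mem hu), add_sub_cancel_left]
  have h3 := (hasDeltaDeriv_transition h H.rdA H.reg ht).mulVec ht (h1.const_mulVec N⁻¹)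
  have hσ := H.isUnit_det (h.sigma_mem ht)
  have e1 : (S.transition A (S.sigma t) S.t₀).mulVec
      (N⁻¹.mulVec (N.mulVec (S.integrand A Q G s φ t))) = S.forcing A Q G s φ t := by
    rw [Matrix.mulVec_mulVec (M := N⁻¹), Matrix.nonsing_inv_mul _ H.isUnit_det_sub_one,
      Matrix.one_mulVec, integrand, Matrix.mulVec_mulVec, Matrix.mul_nonsing_inv _ hσ,
      Matrix.one_mulVec]
  rw [e1, ← Matrix.mulVec_mulVec] at h3
  have e2 : ∀ u, (S.transition A u S.t₀).mulVec (N⁻¹.mulVec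
      (S.deltaIntegral (S.integrand A Q G s φ) u (S.δp T u))) = S.opC A Q G s T φ u := fun u => by
    rw [H.opC_eq, Matrix.mulVec_mulVec]
  simp only [e2] at h3
  exact h3

theorem opC_δp (H : NeutralData S T s A Q G E₁ E₂ E₃) (hφ : φ ∈ S.periodicSpace n T)
    {t : ℝ} (ht : t ∈ S.sub) : S.opC A Q G s T φ (S.δp T t) = S.opC A Q G s T φ t := by
  have h := H.shift
  rw [H.opC_eq, H.opC_eq, H.deltaIntegral_integrand_δp hφ ht (h.δp_mem ht),
    transition_δp h H.rdA H.reg H.perA ht, Matrix.mulVec_mulVec]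
  congr 1
  set Φ := S.transition A T S.t₀
  have hΦ : IsUnit Φ.det := H.isUnit_det h.T_mem
  -- Φ(T) comes from Floquet's relation and Φ(T)⁻¹ from the shifted integral; they cancel because
  -- both commute with (Φ(T)⁻¹ - I)⁻¹.
  have hcomm : Φ * (Φ⁻¹ - 1)⁻¹ * Φ⁻¹ = (Φ⁻¹ - 1)⁻¹ := by
    have hN : IsUnit (Φ⁻¹ - 1).det := H.isUnit_det_sub_one
    have h1 : (Φ⁻¹ - 1) * Φ = Φ * (Φ⁻¹ - 1) := by
      rw [sub_mul, mul_sub, Matrix.nonsing_inv_mul _ hΦ, Matrix.mul_nonsing_inv _ hΦ, one_mul,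
        mul_one]
    have h2 : (Φ⁻¹ - 1)⁻¹ * Φ = Φ * (Φ⁻¹ - 1)⁻¹ := by
      calc (Φ⁻¹ - 1)⁻¹ * Φ = (Φ⁻¹ - 1)⁻¹ * (Φ * (Φ⁻¹ - 1)) * (Φ⁻¹ - 1)⁻¹ := by
            rw [← mul_assoc, Matrix.mul_nonsing_inv_cancel_right _ _ hN]
        _ = Φ * (Φ⁻¹ - 1)⁻¹ := by rw [← h1, Matrix.nonsing_inv_mul_cancel_left _ _ hN]
    rw [← h2, Matrix.mul_nonsing_inv_cancel_right _ _ hΦ]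
  rw [mul_assoc (S.transition A t S.t₀), mul_assoc (S.transition A t S.t₀), hcomm]

theorem opH_δp (H : NeutralData S T s A Q G E₁ E₂ E₃) (hφ : φ ∈ S.periodicSpace n T)
    {t : ℝ} (ht : t ∈ S.sub) : S.opH A Q G s T φ (S.δp T t) = S.opH A Q G s T φ t := by
  simp only [opH]
  rw [H.opC_δp hφ ht]
  simp only [opB]
  rw [H.perQ φ hφ t ht]

theorem periodicInShifts_of_δp (h : S.ShiftPeriodic T) {E : Type*} {x : ℝ → E}
    (hx : ∀ t ∈ S.sub, x (S.δp T t) = x t) : S.PeriodicInShifts T x := fun t ht =>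
  ⟨hx t ht, by
    have := hx _ (h.δm_mem ht)
    rw [h.δp_δm ht] at this
    exact this.symm⟩

theorem opH_mem (H : NeutralData S T s A Q G E₁ E₂ E₃) (hφ : φ ∈ S.periodicSpace n T) :
    S.opH A Q G s T φ ∈ S.periodicSpace n T :=
  ⟨(H.rdContinuous_opB hφ).comp₂ (rdContinuous_of_continuousOn fun _ ht =>
    (H.hasDeltaDeriv_opC hφ ht).continuousWithinAt ht) continuous_add,
    periodicInShifts_of_δp H.shift fun _ ht => H.opH_δp hφ ht⟩

end NeutralData

/-! ### Norms, and uniform limits of rd-continuous functions. -/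

theorem rowNorm_eq_norm (M : Matrix (Fin n) (Fin n) ℝ) : rowNorm M = ‖M‖ := by
  rw [Matrix.linfty_opNorm_def, rowNorm]
  have hbdd : BddAbove (range fun i => ∑ j, |M i j|) := (finite_range _).bddAbove
  apply le_antisymm
  · refine Real.iSup_le (fun i => ?_) (NNReal.coe_nonneg _)
    have := Finset.le_sup (f := fun i => ∑ j, ‖M i j‖₊) (Finset.mem_univ i)
    have := NNReal.coe_le_coe.2 this
    simpa using this
  · have h0 : 0 ≤ ⨆ i, ∑ j, |M i j| :=
      Real.iSup_nonneg fun i => Finset.sum_nonneg fun j _ => abs_nonneg _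
    rw [← NNReal.coe_mk _ h0, NNReal.coe_le_coe]
    refine Finset.sup_le fun i _ => ?_
    rw [← NNReal.coe_le_coe]
    simpa using le_ciSup hbdd i

theorem rowNorm_nonneg (M : Matrix (Fin n) (Fin n) ℝ) : 0 ≤ rowNorm M :=
  rowNorm_eq_norm M ▸ norm_nonneg M

theorem supNorm_nonneg (A : ℝ → Matrix (Fin n) (Fin n) ℝ) : 0 ≤ S.supNorm A := by
  refine Real.sSup_nonneg ?_
  rintro _ ⟨t, -, rfl⟩
  exact rowNorm_nonneg _

theorem kernelBound_nonneg (A : ℝ → Matrix (Fin n) (Fin n) ℝ) (T : ℝ) :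
    0 ≤ S.kernelBound A T := by
  refine Real.sSup_nonneg ?_
  rintro _ ⟨t, -, u, -, rfl⟩
  exact rowNorm_nonneg _

/-- Every point is equivalent to one in [t₀, T], so the supremum over one period controls x on all
of 𝕋*. -/
theorem norm_le_periodicNorm (h : S.ShiftPeriodic T) {x : ℝ → Fin n → ℝ}
    (hx : x ∈ S.periodicSpace n T) {t : ℝ} (ht : t ∈ S.sub) : ‖x t‖ ≤ S.periodicNorm T x := by
  obtain ⟨C, -, hC⟩ := RdContinuous.exists_bound h hx.1 S.t₀_mem h.T_mem
  obtain ⟨v, hv, hvx⟩ := h.exists_mem_period ht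
  rw [← hvx _ x hx.2, periodicNorm, h.δp_t₀]
  refine le_csSup ⟨C, ?_⟩ ⟨v, hv, rfl⟩
  rintro _ ⟨u, hu, rfl⟩
  exact hC u hu

theorem periodicNorm_le (h : S.ShiftPeriodic T) {x : ℝ → Fin n → ℝ} {C : ℝ}
    (hC : ∀ t ∈ S.sub, ‖x t‖ ≤ C) : S.periodicNorm T x ≤ C := by
  rw [periodicNorm, h.δp_t₀]
  refine csSup_le ⟨_, S.t₀, ⟨S.sub_subset S.t₀_mem, le_rfl, h.t₀_lt.le⟩, rfl⟩ ?_
  rintro _ ⟨u, hu, rfl⟩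
  exact hC u (mem_sub_of_le hu.1 hu.2.1)

theorem sub_mem_periodicSpace {x y : ℝ → Fin n → ℝ} (hx : x ∈ S.periodicSpace n T)
    (hy : y ∈ S.periodicSpace n T) : (fun t => x t - y t) ∈ S.periodicSpace n T :=
  ⟨hx.1.comp₂ hy.1 continuous_sub, fun t ht => by
    simp only [(hx.2 t ht).1, (hx.2 t ht).2, (hy.2 t ht).1, (hy.2 t ht).2, and_self]⟩

theorem zero_mem_periodicSpace : (fun _ => 0) ∈ S.periodicSpace n T :=
  ⟨rdContinuous_of_continuousOn continuousOn_const, fun _ _ => ⟨rfl, rfl⟩⟩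

theorem RdContinuous.of_tendstoUniformlyOn {E : Type*} [NormedAddCommGroup E] [CompleteSpace E]
    {F : ℕ → ℝ → E} {f : ℝ → E} (hF : ∀ k, S.RdContinuous (F k))
    (hf : TendstoUniformlyOn F f atTop S.sub) : S.RdContinuous f := by
  intro t ht
  refine ⟨fun e => ?_, ?_⟩
  · refine continuousWithinAt_of_locally_uniform_approx_of_continuousWithinAt ht fun u hu => ?_
    obtain ⟨k, hk⟩ := (hf u hu).exists
    exact ⟨S.sub, self_mem_nhdsWithin, F k, (hF k t ht).1 e, hk⟩
  -- Without points accumulating from the left any limit serves; otherwise an ε/3 argument shows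
  -- that f is Cauchy from the left.
  · rcases eq_or_neBot (𝓝[S.sub ∩ Iio t] t) with hbot | hne
    · exact ⟨0, by rw [hbot]; exact tendsto_bot⟩
    rw [← cauchy_map_iff_exists_tendsto, cauchy_map_iff']
    refine Metric.uniformity_basis_dist.tendsto_right_iff.2 fun ε hε => ?_
    obtain ⟨k, hk⟩ := (Metric.tendstoUniformlyOn_iff.1 hf (ε / 3) (by linarith)).exists
    obtain ⟨L, hL⟩ := (hF k t ht).2
    have hc := Metric.uniformity_basis_dist.tendsto_right_iff.1 (cauchy_map_iff'.1 hL.cauchy_map)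
      (ε / 3) (by linarith)
    have hmem : ∀ᶠ u in 𝓝[S.sub ∩ Iio t] t, u ∈ S.sub :=
      eventually_mem_nhdsWithin.mono fun u hu => hu.1
    filter_upwards [hc, hmem.prod_mk hmem] with p hp hps
    have h1 := hk p.1 hps.1
    have h2 := hk p.2 hps.2
    rw [dist_comm] at h2
    have h3 := dist_triangle4 (f p.1) (F k p.1) (F k p.2) (f p.2)
    have hp' : dist (F k p.1) (F k p.2) < ε / 3 := hp
    change dist (f p.1) (f p.2) < ε
    linarith

/-! ### The contraction estimate. -/

namespace NeutralData

variable {s : ℝ} {Q : ℝ → (Fin n → ℝ) → Fin n → ℝ}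
  {G : ℝ → (Fin n → ℝ) → (Fin n → ℝ) → Fin n → ℝ} {E₁ E₂ E₃ : ℝ} {φ ψ : ℝ → Fin n → ℝ}

/-- The contraction constant. -/
noncomputable def rate (S : ShiftTimeScale) (T : ℝ) (A : ℝ → Matrix (Fin n) (Fin n) ℝ)
    (E₁ E₂ E₃ : ℝ) : ℝ :=
  E₁ + S.kernelBound A T * (S.δp T S.t₀ - S.t₀) * (S.supNorm A * E₁ + E₂ + E₃)

theorem rate_nonneg (H : NeutralData S T s A Q G E₁ E₂ E₃) : 0 ≤ rate S T A E₁ E₂ E₃ := by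
  have h1 := S.kernelBound_nonneg A T
  have h2 := S.supNorm_nonneg A
  have h3 : 0 ≤ S.δp T S.t₀ - S.t₀ := by rw [H.shift.δp_t₀]; exact sub_nonneg.2 H.shift.t₀_lt.le
  have := H.nonneg₁
  have := H.nonneg₂
  have := H.nonneg₃
  rw [rate]
  positivity

theorem norm_le_supNorm (H : NeutralData S T s A Q G E₁ E₂ E₃) {t : ℝ} (ht : t ∈ S.carrier)
    (h0 : S.t₀ ≤ t) : ‖A t‖ ≤ S.supNorm A := by
  rw [← rowNorm_eq_norm]
  exact le_csSup H.bdd ⟨t, ⟨ht, h0⟩, rfl⟩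

theorem kernel_eq (H : NeutralData S T s A Q G E₁ E₂ E₃) {t u : ℝ} (ht : t ∈ S.sub) :
    (S.transition A (S.sigma u) S.t₀ *
      ((S.transition A (S.δp T S.t₀) S.t₀)⁻¹ - 1) * (S.transition A t S.t₀)⁻¹)⁻¹ =
    S.transition A t S.t₀ * ((S.transition A T S.t₀)⁻¹ - 1)⁻¹ *
      (S.transition A (S.sigma u) S.t₀)⁻¹ := by
  rw [H.shift.δp_t₀, Matrix.mul_inv_rev, Matrix.mul_inv_rev,
    Matrix.nonsing_inv_nonsing_inv _ (H.isUnit_det ht), mul_assoc]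

theorem norm_kernel_le (H : NeutralData S T s A Q G E₁ E₂ E₃) {t u : ℝ}
    (ht : t ∈ S.carrier ∩ Icc S.t₀ T) (hu : u ∈ S.carrier ∩ Icc t (S.δp T t)) :
    ‖S.transition A t S.t₀ * ((S.transition A T S.t₀)⁻¹ - 1)⁻¹ *
      (S.transition A (S.sigma u) S.t₀)⁻¹‖ ≤ S.kernelBound A T := by
  have h := H.shift
  have hsub : ∀ {t}, t ∈ S.carrier ∩ Icc S.t₀ T → t ∈ S.sub := fun ht =>
    mem_sub_of_le ht.1 ht.2.1
  -- The supremum defining r needs an upper bound. Here u ≤ δ₊(T), and one further shift leaves room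
  -- for σ(u).
  have hTT := h.δp_mem (h.δp_mem h.T_mem)
  obtain ⟨C, hC0, hC⟩ := (rdContinuous_of_continuousOn
    (continuousOn_transition h H.rdA H.reg)).exists_bound h S.t₀_mem h.T_mem
  obtain ⟨D, hD0, hD⟩ := (rdContinuous_of_continuousOn
    (continuousOn_transition_inv h H.rdA H.reg)).exists_bound h S.t₀_mem hTT
  rw [← rowNorm_eq_norm, ← H.kernel_eq (hsub ht)]
  refine le_csSup ⟨C * ‖((S.transition A T S.t₀)⁻¹ - 1)⁻¹‖ * D, ?_⟩
    ⟨t, by rwa [h.δp_t₀], u, hu, rfl⟩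
  rintro _ ⟨t, ht, u, hu, rfl⟩
  rw [h.δp_t₀] at ht
  have hts := hsub ht
  have hus : u ∈ S.sub := mem_sub_of_le hu.1 (ht.2.1.trans hu.2.1)
  have hu2 : u ≤ S.δp T T := hu.2.2.trans (h.δp_le hts h.T_mem ht.2.2)
  rw [H.kernel_eq hts, rowNorm_eq_norm]
  refine (norm_mul_le _ _).trans (mul_le_mul ((norm_mul_le _ _).trans ?_) ?_ (norm_nonneg _)
    (by positivity))
  · exact mul_le_mul_of_nonneg_right (hC t ht) (norm_nonneg _)
  · exact hD _ ⟨S.sub_subset (h.sigma_mem hus), (ht.2.1.trans hu.2.1).trans (h.le_sigma hus),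
      h.sigma_le hus (S.sub_subset hTT) (hu2.trans_lt (h.lt_δp (h.δp_mem h.T_mem)))⟩

theorem norm_forcing_sub_le (H : NeutralData S T s A Q G E₁ E₂ E₃) {D : ℝ}
    (hD : ∀ t ∈ S.sub, ‖φ t - ψ t‖ ≤ D) {t : ℝ} (ht : t ∈ S.carrier) (h0 : S.t₀ ≤ t) :
    ‖S.forcing A Q G s φ t - S.forcing A Q G s ψ t‖ ≤ (S.supNorm A * E₁ + E₂ + E₃) * D := by
  have hts := mem_sub_of_le ht h0
  have h1 := hD t hts
  have h2 := hD _ (H.delay_mem hts)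
  have h3 := S.supNorm_nonneg A
  have e : S.forcing A Q G s φ t - S.forcing A Q G s ψ t =
      (A t).mulVec (Q t (φ (S.δm s t)) - Q t (ψ (S.δm s t))) +
        (G t (φ t) (φ (S.δm s t)) - G t (ψ t) (ψ (S.δm s t))) := by
    rw [forcing, forcing, Matrix.mulVec_sub]
    abel
  have hQ : ‖(A t).mulVec (Q t (φ (S.δm s t)) - Q t (ψ (S.δm s t)))‖ ≤ S.supNorm A * (E₁ * D) :=
    (Matrix.linfty_opNorm_mulVec _ _).trans (mul_le_mul (H.norm_le_supNorm ht h0)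
      ((H.lipQ t ht h0 _ _).trans (mul_le_mul_of_nonneg_left h2 H.nonneg₁)) (norm_nonneg _) h3)
  have hG := (H.lipG t ht h0 (φ t) (φ (S.δm s t)) (ψ t) (ψ (S.δm s t))).trans
    (add_le_add (mul_le_mul_of_nonneg_left h1 H.nonneg₂) (mul_le_mul_of_nonneg_left h2 H.nonneg₃))
  rw [e]
  refine (norm_add_le_of_le hQ hG).trans_eq ?_
  ring

/-- A direct estimate would give the length δ₊(t) - t, which the shifts do not preserve. Cutting at
T and pulling the second piece back to [t₀, t] replaces it by (T - t) + (t - t₀). -/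
theorem norm_opC_sub_le (H : NeutralData S T s A Q G E₁ E₂ E₃) (hφ : φ ∈ S.periodicSpace n T)
    (hψ : ψ ∈ S.periodicSpace n T) {D : ℝ} (hD : ∀ t ∈ S.sub, ‖φ t - ψ t‖ ≤ D) {t : ℝ}
    (ht : t ∈ S.carrier ∩ Icc S.t₀ T) : ‖S.opC A Q G s T φ t - S.opC A Q G s T ψ t‖ ≤
      S.kernelBound A T * (T - S.t₀) * ((S.supNorm A * E₁ + E₂ + E₃) * D) := by
  have h := H.shift
  have hts : t ∈ S.sub := mem_sub_of_le ht.1 ht.2.1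
  have hφr := H.rdContinuous_integrand hφ
  have hψr := H.rdContinuous_integrand hψ
  set N := (S.transition A T S.t₀)⁻¹ - 1 with hN
  set c := (S.supNorm A * E₁ + E₂ + E₃) * D with hc
  set J := fun a b => S.deltaIntegral
    (fun u => S.integrand A Q G s φ u - S.integrand A Q G s ψ u) a b with hJ
  have hJrd : S.RdContinuous fun u => S.integrand A Q G s φ u - S.integrand A Q G s ψ u :=
    hφr.comp₂ hψr continuous_sub
  have hJe : ∀ u, S.integrand A Q G s φ u - S.integrand A Q G s ψ u =
      (S.transition A (S.sigma u) S.t₀)⁻¹.mulVec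
        (S.forcing A Q G s φ u - S.forcing A Q G s ψ u) := fun u => by
    rw [integrand, integrand, Matrix.mulVec_sub]
  have hJs : ∀ a ∈ S.sub, ∀ b ∈ S.sub, J a b = S.deltaIntegral (S.integrand A Q G s φ) a b -
      S.deltaIntegral (S.integrand A Q G s ψ) a b := fun a ha b hb =>
    hφr.deltaIntegral_sub h hψr ha hb
  have hsplit : J t (S.δp T t) = J t T + (S.transition A T S.t₀)⁻¹.mulVec (J S.t₀ t) := by
    have h1 : J T (S.δp T t) = (S.transition A T S.t₀)⁻¹.mulVec (J S.t₀ t) := by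
      have h2 := H.deltaIntegral_integrand_δp hφ S.t₀_mem hts
      have h3 := H.deltaIntegral_integrand_δp hψ S.t₀_mem hts
      rw [h.δp_t₀] at h2 h3
      rw [hJs _ h.T_mem _ (h.δp_mem hts), hJs _ S.t₀_mem _ hts, h2, h3, Matrix.mulVec_sub]
    rw [← h1]
    exact (hJrd.deltaIntegral_add h hts h.T_mem (h.δp_mem hts)).symm
  have hb : ∀ u ∈ S.carrier, S.t₀ ≤ u → ∀ (M : Matrix (Fin n) (Fin n) ℝ),
      ‖M * (S.transition A (S.sigma u) S.t₀)⁻¹‖ ≤ S.kernelBound A T →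
      ‖M.mulVec (S.integrand A Q G s φ u - S.integrand A Q G s ψ u)‖ ≤ S.kernelBound A T * c := by
    intro u hu h0 M hM
    rw [hJe, Matrix.mulVec_mulVec]
    exact (Matrix.linfty_opNorm_mulVec _ _).trans (mul_le_mul hM
      (H.norm_forcing_sub_le hD hu h0) (norm_nonneg _) (S.kernelBound_nonneg A T))
  set K := S.transition A t S.t₀ * N⁻¹ with hK
  have e : S.opC A Q G s T φ t - S.opC A Q G s T ψ t =
      K.mulVec (J t T) + (K * (S.transition A T S.t₀)⁻¹).mulVec (J S.t₀ t) := by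
    rw [H.opC_eq, H.opC_eq, ← Matrix.mulVec_sub, ← hJs _ hts _ (h.δp_mem hts), hsplit,
      Matrix.mulVec_add, Matrix.mulVec_mulVec]
  have hI1 : ‖K.mulVec (J t T)‖ ≤ S.kernelBound A T * c * (T - t) := by
    rw [hJ, ← hJrd.deltaIntegral_const_mulVec h K hts h.T_mem,
      ← abs_of_nonneg (sub_nonneg.2 ht.2.2)]
    refine h.norm_deltaIntegral_le hts h.T_mem fun u hu hu1 hu2 => ?_
    rw [min_eq_left ht.2.2] at hu1
    rw [max_eq_right ht.2.2] at hu2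
    refine hb u (S.sub_subset hu) (ht.2.1.trans hu1) K
      (H.norm_kernel_le ht ⟨S.sub_subset hu, hu1, hu2.trans ?_⟩)
    have := h.δp_le S.t₀_mem hts ht.2.1
    rwa [h.δp_t₀] at this
  have hI2 : ‖(K * (S.transition A T S.t₀)⁻¹).mulVec (J S.t₀ t)‖ ≤
      S.kernelBound A T * c * (t - S.t₀) := by
    rw [hJ, ← hJrd.deltaIntegral_const_mulVec h _ S.t₀_mem hts,
      ← abs_of_nonneg (sub_nonneg.2 ht.2.1)]
    refine h.norm_deltaIntegral_le S.t₀_mem hts fun u hu hu1 hu2 => ?_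
    rw [min_eq_left ht.2.1] at hu1
    rw [max_eq_right ht.2.1] at hu2
    refine hb u (S.sub_subset hu) hu1 _ ?_
    -- The factor Φ(T)⁻¹ from the pullback turns Φ(σ(u))⁻¹ into Φ(σ(δ₊(u)))⁻¹, so this kernel is
    -- also among those bounded by r, now at δ₊(u) ∈ [T, δ₊(t)].
    rw [mul_assoc, ← Matrix.mul_inv_rev, ← transition_δp h H.rdA H.reg H.perA (h.sigma_mem hu),
      ← h.sigma_δp hu]
    refine H.norm_kernel_le ht ⟨S.sub_subset (h.δp_mem hu), ht.2.2.trans ?_, h.δp_le hu hts hu2⟩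
    have := h.δp_le S.t₀_mem hu hu1
    rwa [h.δp_t₀] at this
  rw [e]
  refine (norm_add_le_of_le hI1 hI2).trans_eq ?_
  ring

/-- `H` is Lipschitz on `P_T` for the uniform distance on `𝕋*`. -/
theorem norm_opH_sub_le (H : NeutralData S T s A Q G E₁ E₂ E₃) (hφ : φ ∈ S.periodicSpace n T)
    (hψ : ψ ∈ S.periodicSpace n T) {D : ℝ} (hD : ∀ t ∈ S.sub, ‖φ t - ψ t‖ ≤ D) {t : ℝ}
    (ht : t ∈ S.sub) :
    ‖S.opH A Q G s T φ t - S.opH A Q G s T ψ t‖ ≤ rate S T A E₁ E₂ E₃ * D := by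
  have h := H.shift
  -- The estimates hold on [t₀, T]; periodicity of both images moves t there.
  obtain ⟨v, hv, hvx⟩ := h.exists_mem_period ht
  rw [← hvx _ _ (H.opH_mem hφ).2, ← hvx _ _ (H.opH_mem hψ).2]
  have hvs := mem_sub_of_le hv.1 hv.2.1
  have h1 : ‖S.opB Q s φ v - S.opB Q s ψ v‖ ≤ E₁ * D :=
    (H.lipQ v hv.1 hv.2.1 _ _).trans
      (mul_le_mul_of_nonneg_left (hD _ (H.delay_mem hvs)) H.nonneg₁)
  have h2 := H.norm_opC_sub_le hφ hψ hD hv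
  rw [opH, opH, add_sub_add_comm]
  refine (norm_add_le_of_le h1 h2).trans_eq ?_
  rw [rate, h.δp_t₀]
  ring

theorem periodicNorm_opH_sub_le (H : NeutralData S T s A Q G E₁ E₂ E₃)
    (hφ : φ ∈ S.periodicSpace n T) (hψ : ψ ∈ S.periodicSpace n T) :
    S.periodicNorm T (fun t => S.opH A Q G s T φ t - S.opH A Q G s T ψ t) ≤
      rate S T A E₁ E₂ E₃ * S.periodicNorm T fun t => φ t - ψ t :=
  periodicNorm_le H.shift fun _ ht => H.norm_opH_sub_le hφ hψ
    (fun _ hu => norm_le_periodicNorm H.shift (sub_mem_periodicSpace hφ hψ) hu) ht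

/-! ### Fixed points of H and periodic solutions. -/

theorem eq_of_fixed (H : NeutralData S T s A Q G E₁ E₂ E₃) (hrate : rate S T A E₁ E₂ E₃ < 1)
    (hφ : φ ∈ S.periodicSpace n T) (hψ : ψ ∈ S.periodicSpace n T)
    (hφf : EqOn (S.opH A Q G s T φ) φ S.sub) (hψf : EqOn (S.opH A Q G s T ψ) ψ S.sub) :
    EqOn φ ψ S.sub := by
  set D := S.periodicNorm T fun t => φ t - ψ t with hDdef
  have hD : ∀ t ∈ S.sub, ‖φ t - ψ t‖ ≤ D := fun t ht =>
    norm_le_periodicNorm H.shift (sub_mem_periodicSpace hφ hψ) ht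
  have h1 : D ≤ rate S T A E₁ E₂ E₃ * D := periodicNorm_le H.shift fun t ht => by
    rw [← hφf ht, ← hψf ht]
    exact H.norm_opH_sub_le hφ hψ hD ht
  have h2 : D ≤ 0 := by nlinarith
  intro t ht
  exact sub_eq_zero.1 (norm_le_zero_iff.1 ((hD t ht).trans h2))

/-- Elements of P_T are functions on ℝ that matter only on 𝕋*, so the contraction principle is
carried out by hand: the Picard iterates of 0 converge geometrically, uniformly on 𝕋*. -/
theorem exists_fixed (H : NeutralData S T s A Q G E₁ E₂ E₃) (hrate : rate S T A E₁ E₂ E₃ < 1) :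
    ∃ x ∈ S.periodicSpace n T, EqOn (S.opH A Q G s T x) x S.sub := by
  set κ := rate S T A E₁ E₂ E₃ with hκ
  have hκ0 : 0 ≤ κ := H.rate_nonneg
  set F : ℕ → ℝ → Fin n → ℝ := fun k => (S.opH A Q G s T)^[k] fun _ => 0 with hF
  have hsucc : ∀ k, F (k + 1) = S.opH A Q G s T (F k) := fun k =>
    Function.iterate_succ_apply' _ _ _
  have hmem : ∀ k, F k ∈ S.periodicSpace n T := fun k => by
    induction k with
    | zero => exact zero_mem_periodicSpace
    | succ k ih => rw [hsucc]; exact H.opH_mem ih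
  set C := S.periodicNorm T fun t => F 0 t - F 1 t with hC
  have hgeom : ∀ k, ∀ t ∈ S.sub, ‖F k t - F (k + 1) t‖ ≤ C * κ ^ k := fun k => by
    induction k with
    | zero =>
      intro t ht
      rw [pow_zero, mul_one]
      exact norm_le_periodicNorm H.shift (sub_mem_periodicSpace (hmem 0) (hmem 1)) ht
    | succ k ih =>
      intro t ht
      rw [hsucc k, hsucc (k + 1), pow_succ', mul_left_comm]
      exact H.norm_opH_sub_le (hmem k) (hmem (k + 1)) ih ht
  have hdist : ∀ t ∈ S.sub, ∀ k, dist (F k t) (F (k + 1) t) ≤ C * κ ^ k := fun t ht k => by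
    rw [dist_eq_norm]
    exact hgeom k t ht
  set x : ℝ → Fin n → ℝ := fun t => limUnder atTop fun k => F k t with hx
  have hlim : ∀ t ∈ S.sub, Tendsto (fun k => F k t) atTop (𝓝 (x t)) := fun t ht =>
    (cauchySeq_of_le_geometric κ C hrate (hdist t ht)).tendsto_limUnder
  have hbound : ∀ k, ∀ t ∈ S.sub, ‖F k t - x t‖ ≤ C * κ ^ k / (1 - κ) := fun k t ht => by
    rw [← dist_eq_norm]
    exact dist_le_of_le_geometric_of_tendsto κ C hrate (hdist t ht) (hlim t ht) k
  have hzero : Tendsto (fun k => C * κ ^ k / (1 - κ)) atTop (𝓝 0) := by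
    have := ((tendsto_pow_atTop_nhds_zero_of_lt_one hκ0 hrate).const_mul C).div_const (1 - κ)
    simpa using this
  have hunif : TendstoUniformlyOn F x atTop S.sub := by
    rw [Metric.tendstoUniformlyOn_iff]
    intro ε hε
    filter_upwards [hzero.eventually_lt_const hε] with k hk t ht
    rw [dist_comm, dist_eq_norm]
    exact (hbound k t ht).trans_lt hk
  have hxmem : x ∈ S.periodicSpace n T := by
    refine ⟨RdContinuous.of_tendstoUniformlyOn (fun k => (hmem k).1) hunif,
      periodicInShifts_of_δp H.shift fun t ht => ?_⟩
    refine tendsto_nhds_unique (hlim _ (H.shift.δp_mem ht)) ((hlim t ht).congr fun k => ?_)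
    exact ((hmem k).2 t ht).1.symm
  refine ⟨x, hxmem, fun t ht => ?_⟩
  -- The iterates F (k + 1) = H(F k) converge at t both to x(t) and, by the Lipschitz estimate, to
  -- (Hx)(t).
  refine tendsto_nhds_unique ?_ ((hlim t ht).comp (tendsto_add_atTop_nat 1))
  rw [tendsto_iff_norm_sub_tendsto_zero]
  refine squeeze_zero (fun _ => norm_nonneg _) (fun k => ?_)
    ((hzero.const_mul κ).trans_eq (by rw [mul_zero]))
  simp only [Function.comp, hsucc]
  exact H.norm_opH_sub_le (hmem k) hxmem (hbound k) ht

/-- A fixed point of `H` solves the neutral equation. -/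
theorem isSolution_of_fixed (H : NeutralData S T s A Q G E₁ E₂ E₃)
    (hφ : φ ∈ S.periodicSpace n T) (hφf : EqOn (S.opH A Q G s T φ) φ S.sub) :
    S.IsSolution A Q G s φ := by
  have hC : ∀ u ∈ S.sub, S.opC A Q G s T φ u = φ u - Q u (φ (S.δm s u)) := fun u hu => by
    have h1 : S.opB Q s φ u + S.opC A Q G s T φ u = φ u := hφf hu
    exact eq_sub_of_add_eq' h1
  intro t ht
  have h1 := (H.hasDeltaDeriv_opC hφ ht).congr H.shift ht hC
  rwa [hC t ht, forcing, Matrix.mulVec_sub, ← add_assoc, sub_add_cancel] at h1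

/-- A periodic solution of the neutral equation is a fixed point of `H`. -/
theorem fixed_of_isSolution (H : NeutralData S T s A Q G E₁ E₂ E₃)
    (hφ : φ ∈ S.periodicSpace n T) (hsol : S.IsSolution A Q G s φ) :
    EqOn (S.opH A Q G s T φ) φ S.sub := by
  have hper : (fun t => φ t - S.opH A Q G s T φ t) ∈ S.periodicSpace n T :=
    sub_mem_periodicSpace hφ (H.opH_mem hφ)
  -- The Q-terms and the forcing cancel in φ - Hφ, leaving a periodic solution of z^Δ = A z.
  have h1 := H.crit _ (fun t ht => ?_) hper.2
  · intro t ht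
    exact (sub_eq_zero.1 (h1 t ht)).symm
  · have h2 := (hsol t ht).sub (H.hasDeltaDeriv_opC hφ ht)
    have e : ∀ u, φ u - Q u (φ (S.δm s u)) - S.opC A Q G s T φ u = φ u - S.opH A Q G s T φ u :=
      fun u => by rw [opH, opB, sub_sub]
    simp only [e] at h2
    convert h2 using 1
    rw [forcing, opH, opB]
    simp only [Matrix.mulVec_sub, Matrix.mulVec_add]
    abel

end NeutralData

end ShiftTimeScale

theorem mainTheorem3 (S : ShiftTimeScale)
    (hconn : ∀ a ∈ S.sub, ∀ b ∈ S.sub, S.carrier ∩ Set.Icc a b ⊆ S.sub)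
    (T : ℝ) (hT : S.IsPeriodic T)
    (s : ℝ) (hs : ∀ t ∈ S.sub, (s, t) ∈ S.domm) (hscont : ContinuousOn (S.δm s) S.sub)
    (n : ℕ)
    (A : ℝ → Matrix (Fin n) (Fin n) ℝ)
    (Q : ℝ → (Fin n → ℝ) → Fin n → ℝ)
    (G : ℝ → (Fin n → ℝ) → (Fin n → ℝ) → Fin n → ℝ)
    (hArd : S.RdContinuous A) (hAreg : S.Regressive A) (hAbdd : BddAbove (S.rowNorms A))
    (hQrd : S.RdContinuous₁ Q) (hGrd : S.RdContinuous₂ G)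
    (hAcrit : S.NonCritical A T)
    (hAper : S.DeltaPeriodicInShifts T A)
    (hQper : ∀ x ∈ S.periodicSpace n T, ∀ t ∈ S.sub,
      Q (S.δp T t) (x (S.δm s (S.δp T t))) = Q t (x (S.δm s t)) ∧
      Q (S.δm T t) (x (S.δm s (S.δm T t))) = Q t (x (S.δm s t)))
    (hGper : ∀ x ∈ S.periodicSpace n T, ∀ t ∈ S.sub,
      S.deltaDeriv (S.δp T) t • G (S.δp T t) (x (S.δp T t)) (x (S.δm s (S.δp T t))) =
        G t (x t) (x (S.δm s t)) ∧
      S.deltaDeriv (S.δm T) t • G (S.δm T t) (x (S.δm T t)) (x (S.δm s (S.δm T t))) =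
        G t (x t) (x (S.δm s t)))
    (hnonzero : ∃ t ∈ S.sub, ∃ q, S.HasDeltaDeriv (fun u => Q u 0) q t ∧ q + G t 0 0 ≠ 0)
    (E₁ E₂ E₃ N : ℝ) (hE₁ : 0 < E₁) (hE₂ : 0 < E₂) (hE₃ : 0 < E₃) (hN : 0 < N)
    (hQlip : ∀ t ∈ S.carrier, S.t₀ ≤ t → ∀ x y, ‖Q t x - Q t y‖ ≤ E₁ * ‖x - y‖)
    (hGlip : ∀ t ∈ S.carrier, S.t₀ ≤ t → ∀ x y z w,
      ‖G t x y - G t z w‖ ≤ E₂ * ‖x - z‖ + E₃ * ‖y - w‖)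
    (hrN : S.kernelBound A T * (S.δp T S.t₀ - S.t₀) * (S.supNorm A * E₁ + E₂ + E₃) ≤ N)
    (hsmall : E₁ + S.kernelBound A T * (S.δp T S.t₀ - S.t₀) * (S.supNorm A * E₁ + E₂ + E₃) < 1) :
    (∀ φ ∈ S.periodicSpace n T, S.opH A Q G s T φ ∈ S.periodicSpace n T) ∧
    (∀ φ ∈ S.periodicSpace n T, ∀ ψ ∈ S.periodicSpace n T,
      S.periodicNorm T (fun t => S.opH A Q G s T φ t - S.opH A Q G s T ψ t) ≤
        (E₁ + S.kernelBound A T * (S.δp T S.t₀ - S.t₀) * (S.supNorm A * E₁ + E₂ + E₃)) *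
          S.periodicNorm T (fun t => φ t - ψ t)) ∧
    ∃ x ∈ S.periodicSpace n T, S.IsSolution A Q G s x ∧
      ∀ y ∈ S.periodicSpace n T, S.IsSolution A Q G s y → ∀ t ∈ S.sub, y t = x t := by
  have H : S.NeutralData T s A Q G E₁ E₂ E₃ :=
    { shift := ⟨hconn, hT⟩
      delay := hs
      delay_cont := hscont
      rdA := hArd
      reg := hAreg
      bdd := hAbdd
      rdQ := hQrd
      rdG := hGrd
      crit := hAcrit
      perA := hAper
      perQ := fun x hx t ht => (hQper x hx t ht).1
      perG := fun x hx t ht => (hGper x hx t ht).1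
      lipQ := hQlip
      lipG := hGlip
      nonneg₁ := hE₁.le
      nonneg₂ := hE₂.le
      nonneg₃ := hE₃.le }
  refine ⟨fun φ hφ => H.opH_mem hφ, fun φ hφ ψ hψ => H.periodicNorm_opH_sub_le hφ hψ, ?_⟩
  obtain ⟨x, hx, hxf⟩ := H.exists_fixed hsmall
  exact ⟨x, hx, H.isSolution_of_fixed hx hxf, fun y hy hsol =>
    H.eq_of_fixed hsmall hy hx (H.fixed_of_isSolution hy hsol) hxf⟩
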